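/- **Theorem (band-limited DFS operator).** Let $\mathbb T=\mathbb R/2\pi\mathbb Z$, let $R_z(\theta),R_y(\theta)\in SO(3)$ be the rotations by $\theta$ about the $z$- and $y$-axis, and let $\phi_{SO(3)}\colon\mathbb T^3\to SO(3)$, $\phi_{SO(3)}(\alpha,\beta,\gamma)=R_z(\alpha)R_y(\beta)R_z(\gamma)$. For $n\in\mathbb N_0$ and $k,l\in\mathbb Z$ with $|k|,|l|\le n$, let $$d_n^{k,l}(x)=(-1)^{\nu}\binom{2n-s}{s+a}^{1/2}\binom{s+b}{b}^{-1/2}\Big(\frac{1-x}{2}\Big)^{a/2}\Big(\frac{1+x}{2}\Big)^{b/2}P_s^{(a,b)}(x),\qquad x\in[-1,1],$$ where $a=|k-l|$, $b=|k+l|$, $s=n-\max\{|k|,|l|\}$, $\nu=k+l$ if $k>l$ and $\nu=0$ otherwise, and $P_s^{(a,b)}$ is the Jacobi polynomial. Let $D_n^{k,l}\colon SO(3)\to\mathbb C$ be the Wigner-D function, determined by $$D_n^{k,l}(\phi_{SO(3)}(\alpha,\beta,\gamma))=\sqrt{2n+1}\,e^{-ik\alpha}\,d_n^{k,l}(\cos\beta)\,e^{-il\gamma}\qquad(\alpha,\gamma\in\mathbb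 T,\ \beta\in[0,\pi]).$$ Let $N\in\mathbb N_0$ and let $f\colon SO(3)\to\mathbb C$ be band-limited of degree $N$, i.e. $f$ lies in the linear span of the $D_n^{k,l}$ with $0\le n\le N$, $|k|,|l|\le n$. Let $\hat f_n^{k,l}=\int_{SO(3)}f\,\overline{D_n^{k,l}}\,d\mu$ be its harmonic coefficients, where $\mu$ is the Haar probability measure on $SO(3)$. Then 1. $f=\sum_{n=0}^N\sum_{k,l=-n}^n\hat f_n^{k,l}D_n^{k,l}$, and the $\hat f_n^{k,l}$ are the only coefficients with which such an expansion of $f$ holds. 2. The DFS transform $f\circ\phi_{SO(3)}$ is a trigonometric polynomial of degree at most $N$ on $\mathbb T^3$, i.e. it lies in $\operatorname{span}\{e^{i\,m\cdot x}: m\in\mathbb Z^3,\ \|m\|_\infty\le N\}$. 3. For all $\alpha,\beta,\gamma\in\mathbb T$, $$f(\phi_{SO(3)}(\alpha,\beta,\gamma))=\sum_{k,j,l=-N}^N(W_N\hat f)_{k,j,l}\,e^{i(k\alpha+j\beta+l\gamma)},$$ where $W_N$ is the linear operator (Wigner transform) $$(W_N\hat f)_{k,j,l}=i^{\,k-l}\sum_{n=\max\{|k|,|j|,|l|\}}^N\sqrt{2n+1}\;d_n^{j,k}(0)\,d_n^{j,l}(0)\,\hat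 f_n^{-k,-l}.$$ Moreover, for every $(k,j,l)\in\mathbb Z^3$, the Fourier coefficient $(2\pi)^{-3}\int_{\mathbb T^3}f(\phi_{SO(3)}(x))\,e^{-i(k,j,l)\cdot x}\,dx$ equals $(W_N\hat f)_{k,j,l}$ (an empty sum, hence $0$, if $\max\{|k|,|j|,|l|\}>N$). -/

import Mathlib

open MeasureTheory

noncomputable section

namespace WignerDFS

/-! ### The circle `𝕋 = ℝ / 2πℤ` and the torus `𝕋³` -/

instance factTwoPiPos : Fact (0 < 2 * Real.pi) := ⟨Real.two_pi_pos⟩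

/-- The circle `𝕋 = ℝ / 2πℤ`. -/
abbrev Circ : Type := AddCircle (2 * Real.pi)

/-- The torus `𝕋³`; its points are triples `(α, β, γ)` of angles. -/
abbrev Torus3 : Type := Fin 3 → Circ

/-- The cosine of an angle in `𝕋`. -/
def cosC (θ : Circ) : ℝ := Real.Angle.cos θ

/-- The sine of an angle in `𝕋`. -/
def sinC (θ : Circ) : ℝ := Real.Angle.sin θ

/-- The character `x ↦ e^{i m·x}` of the torus (`fourier k : Circ → ℂ` is `θ ↦ e^{i k θ}`). -/
def torusChar (m : Fin 3 → ℤ) (x : Torus3) : ℂ := ∏ i, fourier (m i) (x i)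

/-- The trigonometric polynomials on `𝕋³` of degree at most `N`:
the linear span of `e^{i m·x}` with `‖m‖_∞ ≤ N`. -/
def trigPoly (N : ℕ) : Submodule ℂ (Torus3 → ℂ) :=
  Submodule.span ℂ {g | ∃ m : Fin 3 → ℤ, (∀ i, |m i| ≤ (N : ℤ)) ∧ g = torusChar m}

/-- The Fourier coefficient `(2π)⁻³ ∫_{𝕋³} g(x) e^{-i m·x} dx`
(`AddCircle.haarAddCircle` has total mass one). -/
def torusFourierCoeff (g : Torus3 → ℂ) (m : Fin 3 → ℤ) : ℂ :=
  ∫ x, g x * torusChar (-m) x ∂(Measure.pi fun _ : Fin 3 => AddCircle.haarAddCircle)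

/-- The trigonometric polynomial of degree at most `N` with coefficients `c`:
`x ↦ ∑_{k,j,l=-N}^N c_{k,j,l} e^{i (k,j,l)·x}`. -/
def torusSynthesis (N : ℕ) (c : (Fin 3 → ℤ) → ℂ) (x : Torus3) : ℂ :=
  ∑ k ∈ Finset.Icc (-(N : ℤ)) N, ∑ j ∈ Finset.Icc (-(N : ℤ)) N, ∑ l ∈ Finset.Icc (-(N : ℤ)) N,
    c ![k, j, l] * torusChar ![k, j, l] x

/-! ### The rotation group, Euler angles and the Haar measure -/

/-- The rotation group `SO(3)`. -/
abbrev SO3 : Type := Matrix.specialOrthogonalGroup (Fin 3) ℝ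

theorem mem_SO3_iff (A : Matrix (Fin 3) (Fin 3) ℝ) :
    A ∈ Matrix.specialOrthogonalGroup (Fin 3) ℝ ↔ A * A.transpose = 1 ∧ A.det = 1 := by
  rw [Matrix.mem_specialOrthogonalGroup_iff, Matrix.mem_orthogonalGroup_iff]

theorem cosC_sq_add_sinC_sq (θ : Circ) : cosC θ ^ 2 + sinC θ ^ 2 = 1 :=
  Real.Angle.cos_sq_add_sin_sq θ

/-- The rotation about the `z`-axis by the angle `θ`. -/
def rotZ (θ : Circ) : SO3 :=
  ⟨!![cosC θ, -sinC θ, 0; sinC θ, cosC θ, 0; 0, 0, 1], by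
    have h := cosC_sq_add_sinC_sq θ
    rw [mem_SO3_iff]
    constructor
    · ext i j
      fin_cases i <;> fin_cases j <;> simp [Matrix.mul_apply, Fin.sum_univ_three] <;> linarith
    · simp [Matrix.det_fin_three]; linarith⟩

/-- The rotation about the `y`-axis by the angle `θ`. -/
def rotY (θ : Circ) : SO3 :=
  ⟨!![cosC θ, 0, sinC θ; 0, 1, 0; -sinC θ, 0, cosC θ], by
    have h := cosC_sq_add_sinC_sq θ
    rw [mem_SO3_iff]
    constructor
    · ext i j
      fin_cases i <;> fin_cases j <;> simp [Matrix.mul_apply, Fin.sum_univ_three] <;> linarith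
    · simp [Matrix.det_fin_three]; linarith⟩

/-- The rotation `R(α, β, γ) = R_z(α) R_y(β) R_z(γ)`. -/
def euler (α β γ : Circ) : SO3 := rotZ α * rotY β * rotZ γ

/-- The Euler angle parametrization `φ_{SO(3)} : 𝕋³ → SO(3)`. -/
def phiSO3 (x : Torus3) : SO3 := euler (x 0) (x 1) (x 2)

/-- The double Fourier sphere (DFS) operator `f ↦ f ∘ φ_{SO(3)}`. -/
def dfs : (SO3 → ℂ) →ₗ[ℂ] (Torus3 → ℂ) := LinearMap.funLeft ℂ ℂ phiSO3

instance : ContinuousInv SO3 := ⟨by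
  refine Continuous.subtype_mk (f := fun A : SO3 => (A : Matrix (Fin 3) (Fin 3) ℝ).transpose) ?_ _
  exact continuous_subtype_val.matrix_transpose⟩

instance : IsTopologicalGroup SO3 := {}

instance : CompactSpace SO3 := by
  refine isCompact_iff_compactSpace (s := ((Matrix.specialOrthogonalGroup (Fin 3) ℝ : Set (Matrix (Fin 3) (Fin 3) ℝ)))) |>.mp ?_
  have hK : IsCompact (Set.univ.pi fun _ : Fin 3 => Set.univ.pi fun _ : Fin 3 =>
      Set.Icc (-1 : ℝ) 1) :=
    isCompact_univ_pi fun _ => isCompact_univ_pi fun _ => isCompact_Icc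
  have hC : IsClosed {A : Matrix (Fin 3) (Fin 3) ℝ | A * A.transpose = 1 ∧ A.det = 1} := by
    apply IsClosed.inter
    · exact isClosed_eq (continuous_id.matrix_mul continuous_id.matrix_transpose) continuous_const
    · exact isClosed_eq continuous_id.matrix_det continuous_const
  have hE : (Matrix.specialOrthogonalGroup (Fin 3) ℝ : Set (Matrix (Fin 3) (Fin 3) ℝ)) =
      {A | A * A.transpose = 1 ∧ A.det = 1} := Set.ext fun A => mem_SO3_iff A
  rw [hE]
  refine hK.of_isClosed_subset hC ?_
  rintro A ⟨hA, -⟩ i - j -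
  have h := congrFun (congrFun hA i) i
  simp only [Matrix.one_apply_eq] at h
  replace h : ∑ j, A i j * A i j = 1 := h
  have h2 := Finset.single_le_sum (f := fun j => A i j * A i j)
    (fun j _ => mul_self_nonneg (A i j)) (Finset.mem_univ j)
  exact abs_le.mp (abs_le_one_iff_mul_self_le_one.mpr (h2.trans h.le))

instance : MeasurableSpace SO3 := borel SO3

instance : BorelSpace SO3 := ⟨rfl⟩

/-- The Haar measure on the compact group `SO(3)` of total mass one. -/
def haarSO3 : Measure SO3 := Measure.haarMeasure ⊤

/-! ### Wigner functions -/

/-- The Jacobi polynomial `P_s^{(a,b)}`, evaluated at `x`. -/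
def jacobiP (s a b : ℕ) (x : ℝ) : ℝ :=
  ∑ r ∈ Finset.range (s + 1), ((s + a).choose (s - r) : ℝ) * ((s + b).choose r : ℝ) *
    ((x - 1) / 2) ^ r * ((x + 1) / 2) ^ (s - r)

/-- The Wigner-d function `d_n^{k,l} : [-1,1] → ℝ`, for `|k|, |l| ≤ n`; here `a = |k - l|`,
`b = |k + l|`, `s = n - max(|k|,|l|)` and `ν = k + l` if `k > l`, `ν = 0` otherwise. -/
def wignerd (n : ℕ) (k l : ℤ) (x : ℝ) : ℝ :=
  let a : ℕ := (k - l).natAbs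
  let b : ℕ := (k + l).natAbs
  let s : ℕ := n - max k.natAbs l.natAbs
  let ν : ℤ := if l < k then k + l else 0
  (-1) ^ ν * √((2 * n - s).choose (s + a) : ℝ) * (√((s + b).choose b : ℝ))⁻¹ *
    √((1 - x) / 2) ^ a * √((1 + x) / 2) ^ b * jacobiP s a b x

theorem exists_angle (x y r : ℝ) (hr : 0 ≤ r) (h : x ^ 2 + y ^ 2 = r ^ 2) :
    ∃ θ : Circ, x = r * cosC θ ∧ y = r * sinC θ := by
  have hn : ‖(⟨x, y⟩ : ℂ)‖ = r := by
    rw [Complex.norm_def, Complex.normSq_mk, ← Real.sqrt_sq hr, ← h]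
    ring_nf
  refine ⟨((Complex.arg ⟨x, y⟩ : ℝ) : Real.Angle), ?_, ?_⟩
  · have := Complex.norm_mul_cos_arg ⟨x, y⟩
    rw [hn] at this
    exact this.symm
  · have := Complex.norm_mul_sin_arg ⟨x, y⟩
    rw [hn] at this
    exact this.symm

theorem eq_rotZ_of_apply_two_two (M : SO3) (h : M.1 2 2 = 1) : ∃ γ : Circ, M = rotZ γ := by
  obtain ⟨A, hA⟩ := M
  obtain ⟨h1, hd⟩ := (mem_SO3_iff A).mp hA
  have h2 : A.transpose * A = 1 := mul_eq_one_comm.mp h1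
  simp only at h
  have r := fun i j => congrFun (congrFun h1 i) j
  have c := fun i j => congrFun (congrFun h2 i) j
  simp only [Matrix.mul_apply, Matrix.transpose_apply, Fin.sum_univ_three] at r c
  have r22 := r 2 2
  have c22 := c 2 2
  have c00 := c 0 0
  simp only [Matrix.one_apply_eq, h] at r22 c22 c00
  have a20 : A 2 0 = 0 := by nlinarith [sq_nonneg (A 2 0), sq_nonneg (A 2 1)]
  have a21 : A 2 1 = 0 := by nlinarith [sq_nonneg (A 2 0), sq_nonneg (A 2 1)]
  have a02 : A 0 2 = 0 := by nlinarith [sq_nonneg (A 0 2), sq_nonneg (A 1 2)]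
  have a12 : A 1 2 = 0 := by nlinarith [sq_nonneg (A 0 2), sq_nonneg (A 1 2)]
  have r00 := r 0 0
  have r11 := r 1 1
  simp only [Matrix.one_apply_eq, a20, a02, a12] at c00 r00 r11
  rw [Matrix.det_fin_three] at hd
  simp only [h, a20, a21, a02, a12] at hd
  have e1 : A 0 0 = A 1 1 := by
    nlinarith [sq_nonneg (A 0 0 - A 1 1), sq_nonneg (A 0 1 + A 1 0)]
  have e2 : A 0 1 = -A 1 0 := by
    nlinarith [sq_nonneg (A 0 0 - A 1 1), sq_nonneg (A 0 1 + A 1 0)]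
  obtain ⟨γ, hc, hs⟩ := exists_angle (A 0 0) (A 1 0) 1 zero_le_one (by linarith)
  refine ⟨γ, Subtype.ext ?_⟩
  ext i j
  fin_cases i <;> fin_cases j <;> simp [rotZ, h, a20, a21, a02, a12, e2] <;> linarith

theorem coe_inv_SO3 (R : SO3) : (R⁻¹ : SO3).1 = R.1.transpose := rfl

theorem cosC_coe (β : ℝ) : cosC (β : ℝ) = Real.cos β := Real.Angle.cos_coe β

theorem sinC_coe (β : ℝ) : sinC (β : ℝ) = Real.sin β := Real.Angle.sin_coe β

/-- Every rotation has Euler angles `α, γ ∈ 𝕋`, `β ∈ [0, π]`. -/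
theorem exists_euler (R : SO3) :
    ∃ p : Circ × ℝ × Circ, p.2.1 ∈ Set.Icc 0 Real.pi ∧ euler p.1 (p.2.1 : ℝ) p.2.2 = R := by
  have h2 : R.1.transpose * R.1 = 1 := mul_eq_one_comm.mp ((mem_SO3_iff R.1).mp R.2).1
  have c22 := congrFun (congrFun h2 2) 2
  simp only [Matrix.mul_apply, Matrix.transpose_apply, Fin.sum_univ_three,
    Matrix.one_apply_eq] at c22
  have hz : R.1 2 2 ∈ Set.Icc (-1 : ℝ) 1 := by
    rw [Set.mem_Icc, ← abs_le, abs_le_one_iff_mul_self_le_one]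
    nlinarith [sq_nonneg (R.1 0 2), sq_nonneg (R.1 1 2)]
  set β := Real.arccos (R.1 2 2) with hβ
  have hβm : β ∈ Set.Icc 0 Real.pi := ⟨Real.arccos_nonneg _, Real.arccos_le_pi _⟩
  have hc : Real.cos β = R.1 2 2 := Real.cos_arccos hz.1 hz.2
  have hcs := Real.sin_sq_add_cos_sq β
  obtain ⟨α, ha, hb⟩ := exists_angle (R.1 0 2) (R.1 1 2) (Real.sin β)
    (Real.sin_nonneg_of_mem_Icc hβm) (by rw [hc] at hcs; linarith)
  obtain ⟨γ, hγ⟩ := eq_rotZ_of_apply_two_two ((rotY (β : ℝ))⁻¹ * (rotZ α)⁻¹ * R) (by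
    have hα := cosC_sq_add_sinC_sq α
    simp only [Submonoid.coe_mul, coe_inv_SO3, rotY, rotZ, Matrix.mul_apply, Fin.sum_univ_three,
      cosC_coe, sinC_coe, ha, hb, ← hc]
    simp
    linear_combination hcs + Real.sin β ^ 2 * hα)
  refine ⟨(α, β, γ), hβm, ?_⟩
  simp only [euler, ← hγ]
  group

/-- The expression `√(2n+1) e^{-ikα} d_n^{k,l}(cos β) e^{-ilγ}`. -/
def wignerDAngles (n : ℕ) (k l : ℤ) (α : Circ) (β : ℝ) (γ : Circ) : ℂ :=
  (√(2 * n + 1 : ℝ) : ℂ) * fourier (-k) α * (wignerd n k l (Real.cos β) : ℂ) * fourier (-l) γ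

/-- The `L²`-normalized Wigner-D function `D_n^{k,l} : SO(3) → ℂ`, read off from any Euler angles
`α, γ ∈ 𝕋`, `β ∈ [0, π]` of the rotation; see `wignerD_euler` for the independence of the choice. -/
def wignerD (n : ℕ) (k l : ℤ) (R : SO3) : ℂ :=
  let p := (exists_euler R).choose
  wignerDAngles n k l p.1 p.2.1 p.2.2

theorem circ_ext {θ ψ : Circ} (hc : cosC θ = cosC ψ) (hs : sinC θ = sinC ψ) : θ = ψ := by
  induction θ using QuotientAddGroup.induction_on with | H x => ?_
  induction ψ using QuotientAddGroup.induction_on with | H y => ?_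
  exact Real.Angle.cos_sin_inj hc hs

theorem cosC_add (θ ψ : Circ) : cosC (θ + ψ) = cosC θ * cosC ψ - sinC θ * sinC ψ :=
  Real.Angle.cos_add θ ψ

theorem sinC_add (θ ψ : Circ) : sinC (θ + ψ) = sinC θ * cosC ψ + cosC θ * sinC ψ :=
  Real.Angle.sin_add θ ψ

theorem cosC_neg (θ : Circ) : cosC (-θ) = cosC θ := Real.Angle.cos_neg θ

theorem sinC_neg (θ : Circ) : sinC (-θ) = -sinC θ := Real.Angle.sin_neg θ

theorem fourier_angle_add (m : ℤ) (x y : Circ) :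
    (fourier m (x + y) : ℂ) = fourier m x * fourier m y := by
  simp only [fourier_apply, smul_add, AddCircle.toCircle_add, Circle.coe_mul]

theorem fourier_angle_neg (m : ℤ) (x : Circ) : (fourier m (-x) : ℂ) = fourier (-m) x := by
  simp only [fourier_apply, smul_neg, neg_smul]

theorem wignerDAngles_eq_of_euler_eq (n : ℕ) (k l : ℤ) {α γ α' γ' : Circ} {β β' : ℝ}
    (hβ : β ∈ Set.Icc 0 Real.pi) (hβ' : β' ∈ Set.Icc 0 Real.pi)
    (h : euler α (β : ℝ) γ = euler α' (β' : ℝ) γ') :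
    wignerDAngles n k l α β γ = wignerDAngles n k l α' β' γ' := by
  have H := fun i j => congrFun (congrFun (congrArg Subtype.val h) i) j
  simp only [euler, rotZ, rotY, Submonoid.coe_mul, Matrix.mul_apply, Fin.sum_univ_three,
    cosC_coe, sinC_coe] at H
  have h22 := H 2 2
  have h02 := H 0 2
  have h12 := H 1 2
  have h20 := H 2 0
  have h21 := H 2 1
  have h00 := H 0 0
  have h10 := H 1 0
  clear H
  simp at h22 h02 h12 h20 h21 h00 h10
  obtain rfl : β = β' := Real.injOn_cos hβ hβ' h22
  by_cases hs : Real.sin β = 0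
  · have hcos : Real.cos β = 1 ∨ Real.cos β = -1 := by
      have := Real.sin_sq_add_cos_sq β
      rw [hs] at this
      exact mul_self_eq_one_iff.mp (by linarith)
    rcases hcos with hcos | hcos
    · rcases eq_or_ne k l with rfl | hkl
      · have hαγ : α + γ = α' + γ' := by
          apply circ_ext
          · rw [cosC_add, cosC_add]
            rw [hcos] at h00
            linarith
          · rw [sinC_add, sinC_add]
            rw [hcos] at h10
            linarith
        have e := congrArg (fourier (-k) : Circ → ℂ) hαγ
        rw [fourier_angle_add, fourier_angle_add] at e
        simp only [wignerDAngles]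
        linear_combination (√(2 * n + 1 : ℝ) : ℂ) * (wignerd n k k (Real.cos β) : ℂ) * e
      · have ha : (k - l).natAbs ≠ 0 := by omega
        have h0 : wignerd n k l (Real.cos β) = 0 := by simp [wignerd, hcos, ha]
        simp [wignerDAngles, h0]
    · rcases eq_or_ne l (-k) with rfl | hkl
      · have hαγ : α + -γ = α' + -γ' := by
          apply circ_ext
          · rw [cosC_add, cosC_add, cosC_neg, cosC_neg, sinC_neg, sinC_neg]
            rw [hcos] at h00
            linarith
          · rw [sinC_add, sinC_add, cosC_neg, cosC_neg, sinC_neg, sinC_neg]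
            rw [hcos] at h10
            linarith
        have e := congrArg (fourier (-k) : Circ → ℂ) hαγ
        rw [fourier_angle_add, fourier_angle_add, fourier_angle_neg, fourier_angle_neg] at e
        simp only [wignerDAngles]
        linear_combination (√(2 * n + 1 : ℝ) : ℂ) * (wignerd n k (-k) (Real.cos β) : ℂ) * e
      · have hb : (k + l).natAbs ≠ 0 := by omega
        have h0 : wignerd n k l (Real.cos β) = 0 := by simp [wignerd, hcos, hb]
        simp [wignerDAngles, h0]
  · have hα : α = α' := circ_ext (mul_right_cancel₀ hs (by linarith))
      (mul_right_cancel₀ hs (by linarith))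
    have hγ : γ = γ' := circ_ext (mul_left_cancel₀ hs (by linarith))
      (mul_left_cancel₀ hs (by linarith))
    rw [hα, hγ]

/-- `D_n^{k,l}(R(α, β, γ)) = √(2n+1) e^{-ikα} d_n^{k,l}(cos β) e^{-ilγ}` for `β ∈ [0, π]`. -/
theorem wignerD_euler (n : ℕ) (k l : ℤ) (α γ : Circ) (β : ℝ) (hβ : β ∈ Set.Icc 0 Real.pi) :
    wignerD n k l (euler α (β : ℝ) γ) = wignerDAngles n k l α β γ := by
  have hp := (exists_euler (euler α (β : ℝ) γ)).choose_spec
  exact wignerDAngles_eq_of_euler_eq n k l hp.1 hβ hp.2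

/-- The harmonic subspace `Harm_n(SO(3))`: the linear span of the Wigner-D functions
of degree `n`. -/
def harm (n : ℕ) : Submodule ℂ (SO3 → ℂ) :=
  Submodule.span ℂ {g | ∃ k l : ℤ, |k| ≤ (n : ℤ) ∧ |l| ≤ (n : ℤ) ∧ g = wignerD n k l}

/-- The space of `N`-band-limited functions: the sum of `Harm_n(SO(3))`, `0 ≤ n ≤ N`. -/
def bandLimited (N : ℕ) : Submodule ℂ (SO3 → ℂ) := ⨆ n ∈ Finset.range (N + 1), harm n

/-- A family `(c_n^{k,l})` of harmonic coefficients; only the entries with `|k|, |l| ≤ n`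
are ever used. -/
abbrev HarmCoeffs : Type := ℕ → ℤ → ℤ → ℂ

/-- The harmonic coefficients `⟨f, D_n^{k,l}⟩ = ∫ f(R) conj(D_n^{k,l}(R)) dμ(R)`. -/
def harmCoeff (f : SO3 → ℂ) : HarmCoeffs := fun n k l =>
  ∫ R, f R * (starRingEnd ℂ) (wignerD n k l R) ∂haarSO3

/-- The harmonic series `∑_{n=0}^N ∑_{k,l=-n}^n c_n^{k,l} D_n^{k,l}`. -/
def harmSynthesis (N : ℕ) (c : HarmCoeffs) (R : SO3) : ℂ :=
  ∑ n ∈ Finset.range (N + 1), ∑ k ∈ Finset.Icc (-(n : ℤ)) n, ∑ l ∈ Finset.Icc (-(n : ℤ)) n,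
    c n k l * wignerD n k l R

/-! ### The Wigner transform -/

/-- The Wigner transform. The index `m = (m 0, m 1, m 2)` is `(k, j, l)`:
`(W_N c)_{k,j,l}` is `i^{k-l} ∑_{n=max(|k|,|j|,|l|)}^N √(2n+1) d_n^{j,k}(0) d_n^{j,l}(0) c_n^{-k,-l}`,
which is zero unless `|k|, |j|, |l| ≤ N`. -/
def wignerTransform (N : ℕ) : HarmCoeffs →ₗ[ℂ] ((Fin 3 → ℤ) → ℂ) where
  toFun c m :=
    Complex.I ^ (m 0 - m 2) *
      ∑ n ∈ Finset.Icc (max (m 0).natAbs (max (m 1).natAbs (m 2).natAbs)) N,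
        ((√(2 * n + 1 : ℝ) * wignerd n (m 1) (m 0) 0 * wignerd n (m 1) (m 2) 0 : ℝ) : ℂ) *
          c n (-m 0) (-m 2)
  map_add' c d := by
    funext m
    simp only [Pi.add_apply, mul_add, Finset.sum_add_distrib]
  map_smul' z c := by
    funext m
    simp only [Pi.smul_apply, smul_eq_mul, RingHom.id_apply, Finset.mul_sum]
    exact Finset.sum_congr rfl fun n _ => by ring

end WignerDFS

end

open WignerDFS

/-! The proof rests on one algebraic model. The numbers d_n^{k,l}(cos β) are the entries of the
2n-th symmetric power of the half-angle matrix `liftY β` in the normalized monomial basis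
(`wignerd_cos`). Hence D_n^{k,l}(R) is √(2n+1) times an entry of the symmetric power of any lift of
R to SU(2) (`wignerD_eq_symU`). A lift is unique up to sign and the degree 2n is even, so its choice
does not matter; moreover β may now be any angle, not only one in [0, π].

Fourier side: R_y(β) is a conjugate of R_z(β) by quarter turns (`liftY_eq_conj_liftZ`). The
symmetric power of the z-lift is diagonal with entries e^{-ijβ}, so multiplicativity expands
d_n^{k,l} as a trigonometric sum in β. Its coefficients are products of values at cos(π/2) = 0
(`symU_liftY_eq_sum`), and summing over n gives W_N (`dfs_harmSynthesis`).

Harmonic side: the D_n^{k,l} are orthonormal (`integral_wignerD_mul_conj`) by an explicit Schur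
argument. For fixed second indices, the inner products of the matrix coefficients form a matrix that
intertwines two representations. Translation by R_z makes it diagonal; comparing one row at R_y(π/2)
makes it zero or scalar; its trace fixes the scalar. Orthonormality identifies the coefficients of
every expansion with the harmonic coefficients. -/

noncomputable section

namespace WignerDFS

/-! ### Symmetric powers of the standard representation of `2 × 2` matrices -/

section SymPower

open Polynomial

/-- The dehomogenized form `(g₀₀ X + g₁₀)^q (g₀₁ X + g₁₁)^(m - q)`. -/
def symPoly (m : ℕ) (g : Matrix (Fin 2) (Fin 2) ℂ) (q : ℕ) : ℂ[X] :=
  (C (g 0 0) * X + C (g 1 0)) ^ q * (C (g 0 1) * X + C (g 1 1)) ^ (m - q)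

/-- The matrix entries of the `m`-th symmetric power of `g` in the monomial basis. -/
def symCoeff (m : ℕ) (g : Matrix (Fin 2) (Fin 2) ℂ) (p q : ℕ) : ℂ := (symPoly m g q).coeff p

/-- The algebra A is kept general because multiplicativity needs polynomials in place of u and v,
while evaluation needs numbers. -/
theorem symPoly_homogeneous {A : Type*} [CommRing A] [Algebra ℂ A] {m q : ℕ} (hq : q ≤ m)
    (g : Matrix (Fin 2) (Fin 2) ℂ) (u v : A) :
    (algebraMap ℂ A (g 0 0) * u + algebraMap ℂ A (g 1 0) * v) ^ q *
      (algebraMap ℂ A (g 0 1) * u + algebraMap ℂ A (g 1 1) * v) ^ (m - q) =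
    ∑ p ∈ Finset.range (m + 1), algebraMap ℂ A (symCoeff m g p q) * (u ^ p * v ^ (m - p)) := by
  let Q : MvPolynomial (Fin 2) ℂ :=
    (MvPolynomial.C (g 0 0) * .X 0 + MvPolynomial.C (g 1 0) * .X 1) ^ q *
      (MvPolynomial.C (g 0 1) * .X 0 + MvPolynomial.C (g 1 1) * .X 1) ^ (m - q)
  have lin : ∀ a b : ℂ, (MvPolynomial.C a * .X 0 + MvPolynomial.C b * .X 1 :
      MvPolynomial (Fin 2) ℂ).IsHomogeneous 1 := fun a b =>
    ((MvPolynomial.isHomogeneous_X ℂ 0).C_mul a).add ((MvPolynomial.isHomogeneous_X ℂ 1).C_mul b)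
  have hQ : Q.IsHomogeneous m := by
    have h := ((lin (g 0 0) (g 1 0)).pow q).mul ((lin (g 0 1) (g 1 1)).pow (m - q))
    rwa [one_mul, one_mul, Nat.add_sub_cancel' hq] at h
  -- A form of degree m in two variables is determined by its dehomogenization.
  have hP : (symPoly m g q).homogenize m = Q := by
    refine homogenize_eq_of_isHomogeneous hQ ?_
    simp [Q, symPoly, Polynomial.C_eq_algebraMap]
  have hE := congrArg (MvPolynomial.aeval ![u, v]) hP
  simp only [homogenize, map_sum, MvPolynomial.aeval_monomial] at hE
  rw [Finset.Nat.sum_antidiagonal_eq_sum_range_succ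
    (f := fun i j => algebraMap ℂ A ((symPoly m g q).coeff i) *
      Finsupp.prod (fun₀ | 0 => i | 1 => j) fun i k => (![u, v] : Fin 2 → A) i ^ k)] at hE
  simp [Q, Finsupp.prod_fintype, Fin.prod_univ_two] at hE
  exact hE.symm

theorem eval_symPoly {m q : ℕ} (hq : q ≤ m) (g : Matrix (Fin 2) (Fin 2) ℂ) (x : ℂ) :
    (g 0 0 * x + g 1 0) ^ q * (g 0 1 * x + g 1 1) ^ (m - q) =
      ∑ p ∈ Finset.range (m + 1), symCoeff m g p q * x ^ p := by
  simpa using symPoly_homogeneous (A := ℂ) hq g x 1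

/-- Substituting the linear forms of g for the two variables in the form of h produces the form of
the product; coefficients are then compared. -/
theorem symCoeff_mul {m p q : ℕ} (hq : q ≤ m) (g h : Matrix (Fin 2) (Fin 2) ℂ) :
    symCoeff m (g * h) p q =
      ∑ r ∈ Finset.range (m + 1), symCoeff m g p r * symCoeff m h r q := by
  have key : symPoly m (g * h) q =
      ∑ r ∈ Finset.range (m + 1), C (symCoeff m h r q) * symPoly m g r := by
    have := symPoly_homogeneous (A := ℂ[X]) hq h (C (g 0 0) * X + C (g 1 0))
      (C (g 0 1) * X + C (g 1 1))
    simp only [← Polynomial.C_eq_algebraMap] at this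
    simp only [symPoly] at this ⊢
    rw [← this]
    simp only [Matrix.mul_apply, Fin.sum_univ_two, map_add, map_mul]
    congr 2 <;> ring
  rw [symCoeff, key, finsetSum_coeff]
  refine Finset.sum_congr rfl fun r _ => ?_
  rw [coeff_C_mul, mul_comm]
  rfl

theorem eq_of_sum_pow_eq {m : ℕ} {a b : ℕ → ℂ}
    (h : ∀ x : ℂ, ∑ p ∈ Finset.range (m + 1), a p * x ^ p =
      ∑ p ∈ Finset.range (m + 1), b p * x ^ p) {p : ℕ} (hp : p ≤ m) : a p = b p := by
  have e : (∑ p ∈ Finset.range (m + 1), C (a p) * X ^ p : ℂ[X]) =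
      ∑ p ∈ Finset.range (m + 1), C (b p) * X ^ p := by
    refine Polynomial.funext fun x => ?_
    simpa [eval_finsetSum] using h x
  have := congrArg (fun P => coeff P p) e
  simpa [finsetSum_coeff, coeff_C_mul, coeff_X_pow, Nat.lt_succ_of_le hp] using this

/-- Both sides are coefficients of x^p s^q in the m-th power of the bilinear expression (x, 1) g (s,
1)ᵀ, which is unchanged when g is transposed and x, s are exchanged. -/
theorem choose_mul_symCoeff {m p q : ℕ} (hp : p ≤ m) (hq : q ≤ m)
    (g : Matrix (Fin 2) (Fin 2) ℂ) :
    (m.choose q : ℂ) * symCoeff m g p q = (m.choose p : ℂ) * symCoeff m g.transpose q p := by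
  have expand : ∀ (g : Matrix (Fin 2) (Fin 2) ℂ) (s x : ℂ),
      (s * (g 0 0 * x + g 1 0) + (g 0 1 * x + g 1 1)) ^ m =
      ∑ q ∈ Finset.range (m + 1), (∑ p ∈ Finset.range (m + 1),
        ((m.choose q : ℂ) * symCoeff m g p q) * x ^ p) * s ^ q := by
    intro g s x
    rw [add_pow]
    refine Finset.sum_congr rfl fun q hq => ?_
    have hq' : q ≤ m := Nat.lt_succ_iff.mp (Finset.mem_range.mp hq)
    simp only [mul_assoc]
    rw [← Finset.mul_sum, ← eval_symPoly hq', mul_pow]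
    ring
  have h1 : ∀ x s : ℂ, ∑ q ∈ Finset.range (m + 1), (∑ p ∈ Finset.range (m + 1),
        ((m.choose q : ℂ) * symCoeff m g p q) * x ^ p) * s ^ q =
      ∑ q ∈ Finset.range (m + 1), (∑ p ∈ Finset.range (m + 1),
        ((m.choose p : ℂ) * symCoeff m g.transpose q p) * x ^ p) * s ^ q := by
    intro x s
    have e := expand g.transpose x s
    simp only [Matrix.transpose_apply] at e
    rw [← expand g s x]
    trans (x * (g 0 0 * s + g 0 1) + (g 1 0 * s + g 1 1)) ^ m
    · ring
    · rw [e]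
      simp only [Finset.sum_mul]
      rw [Finset.sum_comm]
      refine Finset.sum_congr rfl fun i _ => Finset.sum_congr rfl fun j _ => ?_
      ring
  have h2 := fun x => eq_of_sum_pow_eq (h1 x) hq
  exact eq_of_sum_pow_eq h2 hp

theorem symCoeff_map_conj (m p q : ℕ) (g : Matrix (Fin 2) (Fin 2) ℂ) :
    symCoeff m (g.map (starRingEnd ℂ)) p q = (starRingEnd ℂ) (symCoeff m g p q) := by
  rw [symCoeff, symCoeff, ← coeff_map]
  simp [symPoly]

theorem symCoeff_diag (m p q : ℕ) (z w : ℂ) :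
    symCoeff m !![z, 0; 0, w] p q = if p = q then z ^ q * w ^ (m - q) else 0 := by
  have : symPoly m !![z, 0; 0, w] q = C (z ^ q * w ^ (m - q)) * X ^ q := by
    simp [symPoly, mul_pow]; ring
  rw [symCoeff, this, coeff_C_mul, coeff_X_pow]
  simp

theorem symCoeff_swap (m p q : ℕ) :
    symCoeff m !![0, 1; 1, 0] p q = if p = m - q then 1 else 0 := by
  simp [symCoeff, symPoly, coeff_X_pow]

end SymPower

/-! ### Normalized symmetric powers: adjoints, unitarity and special matrices. -/

/-- The entries of the `m`-th symmetric power of `g` in the normalized monomial basis. -/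
def symU (m : ℕ) (g : Matrix (Fin 2) (Fin 2) ℂ) (p q : ℕ) : ℂ :=
  ((√(m.choose q : ℝ) / √(m.choose p : ℝ) : ℝ) : ℂ) * symCoeff m g p q

theorem sqrt_choose_pos {m p : ℕ} (hp : p ≤ m) : 0 < √(m.choose p : ℝ) :=
  Real.sqrt_pos.mpr (by exact_mod_cast Nat.choose_pos hp)

theorem symU_mul {m q : ℕ} (p : ℕ) (hq : q ≤ m) (g h : Matrix (Fin 2) (Fin 2) ℂ) :
    symU m (g * h) p q = ∑ r ∈ Finset.range (m + 1), symU m g p r * symU m h r q := by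
  rw [symU, symCoeff_mul hq, Finset.mul_sum]
  refine Finset.sum_congr rfl fun r hr => ?_
  have hr' := (sqrt_choose_pos (Nat.lt_succ_iff.mp (Finset.mem_range.mp hr))).ne'
  have : (√(m.choose q : ℝ) / √(m.choose p : ℝ)) =
      (√(m.choose r : ℝ) / √(m.choose p : ℝ)) * (√(m.choose q : ℝ) / √(m.choose r : ℝ)) := by
    field_simp
  rw [symU, symU, this]
  push_cast
  ring

/-- The square-root weights are chosen for this: they split the binomials of `choose_mul_symCoeff`
evenly. With conjugation it follows that adjoints go to adjoints, hence unitary matrices to unitary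
ones. -/
theorem symU_transpose {m p q : ℕ} (hp : p ≤ m) (hq : q ≤ m) (g : Matrix (Fin 2) (Fin 2) ℂ) :
    symU m g.transpose q p = symU m g p q := by
  have h := choose_mul_symCoeff hp hq g
  have hp' : (√(m.choose p : ℝ) : ℂ) ≠ 0 := by exact_mod_cast (sqrt_choose_pos hp).ne'
  have hq' : (√(m.choose q : ℝ) : ℂ) ≠ 0 := by exact_mod_cast (sqrt_choose_pos hq).ne'
  have ep : (√(m.choose p : ℝ) : ℂ) ^ 2 = m.choose p := by
    exact_mod_cast Real.sq_sqrt (Nat.cast_nonneg (m.choose p))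
  have eq : (√(m.choose q : ℝ) : ℂ) ^ 2 = m.choose q := by
    exact_mod_cast Real.sq_sqrt (Nat.cast_nonneg (m.choose q))
  rw [← ep, ← eq] at h
  simp only [symU]
  push_cast
  field_simp
  linear_combination -h

theorem symU_conjTranspose {m p q : ℕ} (hp : p ≤ m) (hq : q ≤ m)
    (g : Matrix (Fin 2) (Fin 2) ℂ) :
    symU m g.conjTranspose q p = (starRingEnd ℂ) (symU m g p q) := by
  have : g.conjTranspose = (g.map (starRingEnd ℂ)).transpose := by ext i j; simp
  rw [this, symU_transpose hp hq, symU, symU, symCoeff_map_conj]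
  simp

theorem symU_diag {m q : ℕ} (p : ℕ) (hq : q ≤ m) (z w : ℂ) :
    symU m !![z, 0; 0, w] p q = if p = q then z ^ q * w ^ (m - q) else 0 := by
  rw [symU, symCoeff_diag]
  split_ifs with h
  · subst h
    rw [div_self (sqrt_choose_pos hq).ne']
    simp
  · simp

theorem symU_swap {m q : ℕ} (p : ℕ) (hq : q ≤ m) :
    symU m !![0, 1; 1, 0] p q = if p = m - q then 1 else 0 := by
  rw [symU, symCoeff_swap]
  split_ifs with h
  · subst h
    rw [Nat.choose_symm hq, div_self (sqrt_choose_pos hq).ne']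
    simp
  · simp

theorem symU_one {m q : ℕ} (p : ℕ) (hq : q ≤ m) : symU m 1 p q = if p = q then 1 else 0 := by
  have := symU_diag p hq 1 1
  rw [← Matrix.one_fin_two] at this
  simpa using this

theorem symU_diag_mul {m p q : ℕ} (hp : p ≤ m) (hq : q ≤ m) (z w : ℂ)
    (g : Matrix (Fin 2) (Fin 2) ℂ) :
    symU m (!![z, 0; 0, w] * g) p q = z ^ p * w ^ (m - p) * symU m g p q := by
  rw [symU_mul p hq, Finset.sum_eq_single p]
  · rw [symU_diag p hp, if_pos rfl]
  · intro r hr hne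
    rw [symU_diag p (Nat.lt_succ_iff.mp (Finset.mem_range.mp hr)), if_neg hne.symm, zero_mul]
  · intro h
    exact absurd (Finset.mem_range.mpr (Nat.lt_succ_of_le hp)) h

theorem symU_mul_diag {m q : ℕ} (p : ℕ) (hq : q ≤ m) (z w : ℂ)
    (g : Matrix (Fin 2) (Fin 2) ℂ) :
    symU m (g * !![z, 0; 0, w]) p q = symU m g p q * (z ^ q * w ^ (m - q)) := by
  rw [symU_mul p hq, Finset.sum_eq_single q]
  · rw [symU_diag q hq, if_pos rfl]
  · intro r hr hne
    rw [symU_diag r hq, if_neg hne, mul_zero]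
  · intro h
    exact absurd (Finset.mem_range.mpr (Nat.lt_succ_of_le hq)) h

theorem symU_swap_mul_swap {m p q : ℕ} (hp : p ≤ m) (hq : q ≤ m)
    (g : Matrix (Fin 2) (Fin 2) ℂ) :
    symU m (!![0, 1; 1, 0] * g * !![0, 1; 1, 0]) p q = symU m g (m - p) (m - q) := by
  rw [symU_mul p hq, Finset.sum_eq_single (m - q)]
  · rw [symU_swap _ hq, if_pos rfl, mul_one, symU_mul p (Nat.sub_le m q),
      Finset.sum_eq_single (m - p)]
    · rw [symU_swap _ (Nat.sub_le m p), if_pos (by omega), one_mul]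
    · intro r hr hne
      have := Finset.mem_range.mp hr
      rw [symU_swap _ (by omega), if_neg (by omega), zero_mul]
    · intro h
      exact absurd (Finset.mem_range.mpr (by omega)) h
  · intro r hr hne
    rw [symU_swap _ hq, if_neg hne, mul_zero]
  · intro h
    exact absurd (Finset.mem_range.mpr (by omega)) h

/-- The entries of the symmetric power of a unitary matrix have orthonormal columns. -/
theorem symU_unitary {m q q' : ℕ} (hq : q ≤ m) (hq' : q' ≤ m) {g : Matrix (Fin 2) (Fin 2) ℂ}
    (hg : g.conjTranspose * g = 1) :
    ∑ p ∈ Finset.range (m + 1), symU m g p q' * (starRingEnd ℂ) (symU m g p q) =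
      if q = q' then 1 else 0 := by
  rw [← symU_one q hq', ← hg, symU_mul q hq']
  refine Finset.sum_congr rfl fun p hp => ?_
  rw [symU_conjTranspose (Nat.lt_succ_iff.mp (Finset.mem_range.mp hp)) hq, mul_comm]

/-- This is what lets even symmetric powers descend from SU(2) to SO(3). -/
theorem symU_neg {m p q : ℕ} (hm : Even m) (hp : p ≤ m) (hq : q ≤ m)
    (g : Matrix (Fin 2) (Fin 2) ℂ) : symU m (-g) p q = symU m g p q := by
  have : -g = !![-1, 0; 0, -1] * g := by
    ext i j
    fin_cases i <;> simp [Matrix.mul_apply, Fin.sum_univ_two]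
  rw [this, symU_diag_mul hp hq, ← pow_add, Nat.add_sub_cancel' hp, hm.neg_one_pow, one_mul]

/-! ### Wigner-d functions as entries of symmetric powers of rotations -/

/-- The lift of the rotation about the `z`-axis by `α` to `SU(2)`. -/
def liftZ (α : ℝ) : Matrix (Fin 2) (Fin 2) ℂ :=
  !![Complex.exp (-(α / 2 : ℝ) * Complex.I), 0; 0, Complex.exp ((α / 2 : ℝ) * Complex.I)]

/-- The lift of the rotation about the `y`-axis by `β` to `SU(2)`. -/
def liftY (β : ℝ) : Matrix (Fin 2) (Fin 2) ℂ :=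
  !![(Real.cos (β / 2) : ℂ), -(Real.sin (β / 2) : ℂ);
    (Real.sin (β / 2) : ℂ), (Real.cos (β / 2) : ℂ)]

/-- Three descriptions of `liftY (-β)`, as a transpose and as two conjugates, are compared below;
each pair yields a symmetry of the entries under exchange or reversal of indices. -/
theorem liftY_neg_eq_transpose (β : ℝ) : liftY (-β) = (liftY β).transpose := by
  ext i j
  fin_cases i <;> fin_cases j <;> simp [liftY, neg_div]

theorem liftY_neg_eq_diag (β : ℝ) :
    liftY (-β) = !![1, 0; 0, -1] * (liftY β * !![1, 0; 0, -1]) := by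
  ext i j
  fin_cases i <;> fin_cases j <;> simp [liftY, neg_div]

theorem liftY_neg_eq_swap (β : ℝ) :
    liftY (-β) = !![0, 1; 1, 0] * liftY β * !![0, 1; 1, 0] := by
  ext i j
  fin_cases i <;> fin_cases j <;> simp [liftY, neg_div]

theorem symU_liftY_neg {m p q : ℕ} (hm : Even m) (hp : p ≤ m) (hq : q ≤ m) (β : ℝ) :
    symU m (liftY (-β)) p q = (-1) ^ (p + q) * symU m (liftY β) p q := by
  rw [liftY_neg_eq_diag, symU_diag_mul hp hq, symU_mul_diag p hq, one_pow, one_pow, one_mul,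
    one_mul, pow_add]
  have h : ∀ r ≤ m, (-1 : ℂ) ^ (m - r) = (-1) ^ r := by
    intro r hr
    have h : (-1 : ℂ) ^ (m - r) * (-1) ^ r = 1 := by
      rw [← pow_add, Nat.sub_add_cancel hr, hm.neg_one_pow]
    have h' : (-1 : ℂ) ^ r * (-1) ^ r = 1 := by rw [← mul_pow]; norm_num
    linear_combination (-1 : ℂ) ^ r * h - (-1 : ℂ) ^ (m - r) * h'
  rw [h p hp, h q hq]
  ring

theorem symU_liftY_swap {m p q : ℕ} (hm : Even m) (hp : p ≤ m) (hq : q ≤ m) (β : ℝ) :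
    symU m (liftY β) q p = (-1) ^ (p + q) * symU m (liftY β) p q := by
  rw [← symU_liftY_neg hm hp hq, liftY_neg_eq_transpose, symU_transpose hq hp]

theorem symU_liftY_reverse {m p q : ℕ} (hm : Even m) (hp : p ≤ m) (hq : q ≤ m) (β : ℝ) :
    symU m (liftY β) (m - p) (m - q) = (-1) ^ (p + q) * symU m (liftY β) p q := by
  rw [← symU_liftY_neg hm hp hq, liftY_neg_eq_swap, symU_swap_mul_swap hp hq]

open Polynomial in
theorem coeff_linear_pow (u v : ℂ) (k i : ℕ) :
    ((C u * X + C v) ^ k).coeff i = (k.choose i : ℂ) * u ^ i * v ^ (k - i) := by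
  rw [add_pow, finsetSum_coeff]
  have : ∀ j, (C u * X) ^ j * C v ^ (k - j) * (k.choose j : ℂ[X]) =
      C (u ^ j * v ^ (k - j) * (k.choose j : ℂ)) * X ^ j := by
    intro j
    simp only [mul_pow, map_mul, map_pow, map_natCast]
    ring
  simp only [this, coeff_C_mul, coeff_X_pow]
  rcases le_or_gt i k with h | h
  · simp [Nat.lt_succ_of_le h]; ring
  · simp [Nat.choose_eq_zero_of_lt h]

/-- The indices are those of the case k ≥ |l|, with a = k - l, b = k + l, s = n - k. The remaining
sum is the Jacobi polynomial at cos β, since (cos β - 1)/2 = -sin²(β/2) and (cos β + 1)/2 =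
cos²(β/2). -/
theorem symCoeff_liftY (s a b : ℕ) (β : ℝ) :
    symCoeff (2 * s + a + b) (liftY β) (s + a + b) (s + b) =
      (((-1) ^ a * Real.sin (β / 2) ^ a * Real.cos (β / 2) ^ b *
        ∑ r ∈ Finset.range (s + 1), ((s + a).choose (s - r) : ℝ) * ((s + b).choose r : ℝ) *
          (-Real.sin (β / 2) ^ 2) ^ r * (Real.cos (β / 2) ^ 2) ^ (s - r) : ℝ) : ℂ) := by
  rw [symCoeff, symPoly, Polynomial.coeff_mul, ← Finset.Nat.sum_antidiagonal_swap,
    Finset.Nat.sum_antidiagonal_eq_sum_range_succ_mk]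
  simp only [coeff_linear_pow, Prod.swap]
  -- The summation index is the exponent taken from the second factor. Below a the first factor has
  -- too small a degree, above s + a the second one; only s + 1 terms survive.
  rw [show (s + a + b).succ = a + ((s + 1) + b) by omega, Finset.sum_range_add,
    Finset.sum_range_add, Finset.sum_eq_zero, zero_add, Finset.sum_eq_zero (s := Finset.range b),
    add_zero]
  · simp only [liftY, Matrix.of_apply, Matrix.cons_val', Matrix.cons_val_zero,
      Matrix.cons_val_one, Matrix.cons_val_fin_one]
    generalize Real.sin (β / 2) = S
    generalize Real.cos (β / 2) = K
    push_cast
    rw [Finset.mul_sum]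
    refine Finset.sum_congr rfl fun r hr => ?_
    have hr' := Nat.lt_succ_iff.mp (Finset.mem_range.mp hr)
    rw [show s + a + b - (a + r) = s + b - r by omega,
      show 2 * s + a + b - (s + b) = s + a by omega, show s + b - (s + b - r) = r by omega,
      show s + a - (a + r) = s - r by omega, Nat.choose_symm (show r ≤ s + b by omega),
      ← Nat.choose_symm (show a + r ≤ s + a by omega), show s + a - (a + r) = s - r by omega,
      show s + b - r = b + (s - r) by omega]
    rw [neg_pow ((S : ℂ) ^ 2) r, neg_pow (S : ℂ)]
    ring
  · intro r hr
    rw [show 2 * s + a + b - (s + b) = s + a by omega,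
      Nat.choose_eq_zero_of_lt (show s + a < a + (s + 1 + r) by omega)]
    simp
  · intro r hr
    have hr' := Finset.mem_range.mp hr
    rw [Nat.choose_eq_zero_of_lt (show s + b < s + a + b - r by omega)]
    simp

theorem sqrt_choose_ratio (s a b : ℕ) :
    √((2 * s + a + b).choose (s + b) : ℝ) / √((2 * s + a + b).choose (s + a + b) : ℝ) =
      √((s + a + b).choose (s + a) : ℝ) * (√((s + b).choose b : ℝ))⁻¹ := by
  rw [← div_eq_mul_inv, div_eq_div_iff (sqrt_choose_pos (by omega)).ne'
    (sqrt_choose_pos (by omega)).ne', ← Real.sqrt_mul (Nat.cast_nonneg _),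
    ← Real.sqrt_mul (Nat.cast_nonneg _)]
  congr 1
  norm_cast
  -- Both products share the factor C(2s+a+b, b); what remains is C(2s+a, s) = C(2s+a, s+a).
  have h1 := Nat.choose_mul (n := 2 * s + a + b) (k := s + b) (s := b) (by omega)
  have h2 := Nat.choose_mul (n := 2 * s + a + b) (k := s + a + b) (s := b) (by omega)
  rw [h1, mul_comm, show (s + a + b).choose (s + a) = (s + a + b).choose b from
    (Nat.choose_symm_of_eq_add (by omega)), mul_comm ((s + a + b).choose b), h2, mul_comm]
  congr 1
  exact Nat.choose_symm_of_eq_add (by omega)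

theorem sqrt_half_sub_cos {β : ℝ} (hβ : β ∈ Set.Icc 0 Real.pi) :
    √((1 - Real.cos β) / 2) = Real.sin (β / 2) :=
  (Real.sin_half_eq_sqrt hβ.1 (by linarith [hβ.2, Real.pi_pos])).symm

theorem sqrt_half_add_cos {β : ℝ} (hβ : β ∈ Set.Icc 0 Real.pi) :
    √((1 + Real.cos β) / 2) = Real.cos (β / 2) :=
  (Real.cos_half (by linarith [hβ.1, Real.pi_pos]) hβ.2).symm

/-! ### Index symmetries of d_n^{k,l} and identification with symmetric powers. -/

theorem wignerd_swap (n : ℕ) (k l : ℤ) (x : ℝ) :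
    wignerd n l k x = (-1) ^ (k + l) * wignerd n k l x := by
  have h2 : ((-1 : ℝ) ^ (k + l)) * (-1) ^ (k + l) = 1 := by
    rw [← mul_zpow]; norm_num
  simp only [wignerd]
  rw [show (l - k).natAbs = (k - l).natAbs by omega, add_comm l k, max_comm l.natAbs]
  rcases lt_trichotomy k l with h | h | h
  · rw [if_pos h, if_neg (by omega)]
    simp only [zpow_zero]
    ring
  · subst h
    simp only [lt_irrefl, if_false]
    rw [(show Even (k + k) from ⟨k, rfl⟩).neg_one_zpow, one_mul]
  · rw [if_neg (by omega), if_pos h]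
    simp only [zpow_zero, ← mul_assoc, h2]

theorem wignerd_neg (n : ℕ) (k l : ℤ) (x : ℝ) :
    wignerd n (-k) (-l) x = wignerd n l k x := by
  simp only [wignerd]
  rw [show (-k - -l).natAbs = (l - k).natAbs by omega,
    show (-k + -l).natAbs = (l + k).natAbs by omega, Int.natAbs_neg, Int.natAbs_neg,
    max_comm l.natAbs]
  congr 5
  by_cases h : k < l
  · rw [if_pos h, if_pos (by omega), show -k + -l = -(l + k) by ring, zpow_neg, ← inv_zpow]
    norm_num
  · rw [if_neg h, if_neg (by omega)]

theorem neg_one_pow_toNat_add {n : ℕ} {k l : ℤ} (hk : |k| ≤ n) (hl : |l| ≤ n) :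
    (-1 : ℂ) ^ ((n + k).toNat + (n + l).toNat) = (-1) ^ (k + l) := by
  rw [abs_le] at hk hl
  rw [← zpow_natCast, show (((n + k).toNat + (n + l).toNat : ℕ) : ℤ) = k + l + (n + n) by omega,
    zpow_add₀ (by norm_num), (show Even ((n : ℤ) + n) from ⟨n, rfl⟩).neg_one_zpow, mul_one]

theorem wignerd_cos_of_abs_le {n : ℕ} {k l : ℤ} (hk : k ≤ n) (hl : |l| ≤ k) {β : ℝ}
    (hβ : β ∈ Set.Icc 0 Real.pi) :
    (wignerd n k l (Real.cos β) : ℂ) = symU (2 * n) (liftY β) (n + k).toNat (n + l).toNat := by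
  rw [abs_le] at hl
  obtain ⟨a, ha⟩ : ∃ a : ℕ, k - l = a := ⟨(k - l).toNat, by omega⟩
  obtain ⟨b, hb⟩ : ∃ b : ℕ, k + l = b := ⟨(k + l).toNat, by omega⟩
  obtain ⟨s, hs⟩ : ∃ s : ℕ, (n : ℤ) - k = s := ⟨(n - k).toNat, by omega⟩
  have hs' : n - max k.natAbs l.natAbs = s := by omega
  -- For l < k the exponent k + l = a + 2l has the parity of a; for l = k both exponents are 0.
  have hν : (-1 : ℝ) ^ (if l < k then k + l else 0 : ℤ) = (-1) ^ a := by
    split_ifs with h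
    · rw [show k + l = a + (l + l) by omega, zpow_add₀ (by norm_num),
        (show Even (l + l) from ⟨l, rfl⟩).neg_one_zpow, mul_one, zpow_natCast]
    · rw [show a = 0 by omega]; simp
  have h1 : (Real.cos β - 1) / 2 = -Real.sin (β / 2) ^ 2 := by
    have := Real.cos_two_mul' (β / 2)
    rw [mul_div_cancel₀ _ two_ne_zero] at this
    have h2 := Real.sin_sq_add_cos_sq (β / 2)
    rw [this]; linarith
  have h2 : (Real.cos β + 1) / 2 = Real.cos (β / 2) ^ 2 := by
    have := Real.cos_two_mul' (β / 2)
    rw [mul_div_cancel₀ _ two_ne_zero] at this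
    have h2 := Real.sin_sq_add_cos_sq (β / 2)
    rw [this]; linarith
  rw [show (n + k).toNat = s + a + b by omega, show (n + l).toNat = s + b by omega,
    show 2 * n = 2 * s + a + b by omega, symU, symCoeff_liftY, sqrt_choose_ratio]
  simp only [wignerd, jacobiP]
  rw [hν, hs', show (k - l).natAbs = a by omega, show (k + l).natAbs = b by omega,
    show 2 * n - s = s + a + b by omega, sqrt_half_sub_cos hβ, sqrt_half_add_cos hβ, h1, h2]
  rw [← Complex.ofReal_mul]
  congr 1
  ring

/-- Exchanging k and l, or negating both, multiplies each side by the same sign (-1)^(k+l). These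
two moves bring every pair into the region k ≥ |l| already treated. -/
theorem wignerd_cos {n : ℕ} {k l : ℤ} (hk : |k| ≤ n) (hl : |l| ≤ n) {β : ℝ}
    (hβ : β ∈ Set.Icc 0 Real.pi) :
    (wignerd n k l (Real.cos β) : ℂ) = symU (2 * n) (liftY β) (n + k).toNat (n + l).toNat := by
  have swap : ∀ {k l : ℤ}, |k| ≤ n → |l| ≤ n →
      (wignerd n l k (Real.cos β) : ℂ) = symU (2 * n) (liftY β) (n + l).toNat (n + k).toNat →
      (wignerd n k l (Real.cos β) : ℂ) =
        symU (2 * n) (liftY β) (n + k).toNat (n + l).toNat := by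
    intro k l hk hl h
    rw [wignerd_swap, Complex.ofReal_mul, h, symU_liftY_swap (even_two_mul n) (q := (n + k).toNat)
      (by rw [abs_le] at hl; omega) (by rw [abs_le] at hk; omega), neg_one_pow_toNat_add hl hk]
    push_cast
    rfl
  have neg : ∀ {k l : ℤ}, |k| ≤ n → |l| ≤ n →
      (wignerd n (-k) (-l) (Real.cos β) : ℂ) =
        symU (2 * n) (liftY β) (n + -k).toNat (n + -l).toNat →
      (wignerd n k l (Real.cos β) : ℂ) =
        symU (2 * n) (liftY β) (n + k).toNat (n + l).toNat := by
    intro k l hk hl h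
    have e := symU_liftY_reverse (even_two_mul n) (p := (n + -k).toNat) (q := (n + -l).toNat)
      (by rw [abs_le] at hk; omega) (by rw [abs_le] at hl; omega) β
    rw [neg_one_pow_toNat_add (by rwa [abs_neg]) (by rwa [abs_neg]), ← h,
      show 2 * n - (n + -k).toNat = (n + k).toNat by rw [abs_le] at hk; omega,
      show 2 * n - (n + -l).toNat = (n + l).toNat by rw [abs_le] at hl; omega] at e
    rw [e, ← neg_neg k, ← neg_neg l, wignerd_neg, wignerd_swap, neg_neg, neg_neg]
    push_cast
    rfl
  have base : ∀ {k l : ℤ}, |k| ≤ n → |l| ≤ k → (wignerd n k l (Real.cos β) : ℂ) =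
        symU (2 * n) (liftY β) (n + k).toNat (n + l).toNat := fun hk hl =>
    wignerd_cos_of_abs_le ((le_abs_self _).trans hk) hl hβ
  have hk' : |-k| ≤ n := by rwa [abs_neg]
  have hl' : |-l| ≤ n := by rwa [abs_neg]
  rcases le_total |l| |k| with h | h
  · rcases abs_cases k with ⟨e, -⟩ | ⟨e, -⟩
    · exact base hk (e ▸ h)
    · exact neg hk hl (base hk' (by rw [abs_neg]; exact e ▸ h))
  · rcases abs_cases l with ⟨e, -⟩ | ⟨e, -⟩
    · exact swap hk hl (base hl (e ▸ h))
    · exact swap hk hl (neg hl hk (base hl' (by rw [abs_neg]; exact e ▸ h)))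

/-! ### The double cover `SU(2) → SO(3)` -/

/-- The Pauli matrices. -/
def pauli : Fin 3 → Matrix (Fin 2) (Fin 2) ℂ :=
  ![!![0, 1; 1, 0], !![0, -Complex.I; Complex.I, 0], !![1, 0; 0, -1]]

/-- `g ∈ SU(2)` is a lift of the rotation `R`. -/
structure IsLift (g : Matrix (Fin 2) (Fin 2) ℂ) (R : SO3) : Prop where
  unitary : g.conjTranspose * g = 1
  det : g.det = 1
  intertwine : ∀ j, g * pauli j = (∑ i, (R.1 i j : ℂ) • pauli i) * g

theorem IsLift.mul {g h : Matrix (Fin 2) (Fin 2) ℂ} {R S : SO3} (hg : IsLift g R)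
    (hh : IsLift h S) : IsLift (g * h) (R * S) where
  unitary := by
    rw [Matrix.conjTranspose_mul, Matrix.mul_assoc, ← Matrix.mul_assoc _ g, hg.unitary,
      Matrix.one_mul, hh.unitary]
  det := by rw [Matrix.det_mul, hg.det, hh.det, one_mul]
  intertwine j := by
    rw [Matrix.mul_assoc, hh.intertwine, ← Matrix.mul_assoc, ← Matrix.mul_assoc]
    congr 1
    rw [Finset.mul_sum]
    simp only [Matrix.mul_smul, hg.intertwine]
    simp only [← Matrix.smul_mul, ← Finset.sum_mul, Finset.smul_sum, smul_smul]
    congr 1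
    rw [Finset.sum_comm]
    refine Finset.sum_congr rfl fun k _ => ?_
    rw [← Finset.sum_smul]
    congr 1
    simp only [Submonoid.coe_mul, Matrix.mul_apply]
    push_cast
    exact Finset.sum_congr rfl fun _ _ => mul_comm _ _

/-- The quotient k = h* g of two lifts commutes with the Pauli matrices, so it is scalar;
determinant one leaves only ±1. -/
theorem IsLift.eq_or_eq_neg {g h : Matrix (Fin 2) (Fin 2) ℂ} {R : SO3} (hg : IsLift g R)
    (hh : IsLift h R) : g = h ∨ g = -h := by
  have hh' : h * h.conjTranspose = 1 := mul_eq_one_comm.mp hh.unitary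
  set k := h.conjTranspose * g with hk
  have hgk : g = h * k := by rw [hk, ← Matrix.mul_assoc, hh', Matrix.one_mul]
  have hcomm : ∀ j, k * pauli j = pauli j * k := by
    intro j
    have e : h.conjTranspose * (∑ i, (R.1 i j : ℂ) • pauli i) = pauli j * h.conjTranspose := by
      calc h.conjTranspose * (∑ i, (R.1 i j : ℂ) • pauli i)
          = h.conjTranspose * ((∑ i, (R.1 i j : ℂ) • pauli i) * h) * h.conjTranspose := by
            simp only [Matrix.mul_assoc]; rw [hh', Matrix.mul_one]
        _ = pauli j * h.conjTranspose := by
            rw [← hh.intertwine, ← Matrix.mul_assoc, hh.unitary, Matrix.one_mul]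
    rw [hk, Matrix.mul_assoc, hg.intertwine, ← Matrix.mul_assoc, e, Matrix.mul_assoc]
  have h0 := fun i j => congrFun (congrFun (hcomm 0) i) j
  have h2 := fun i j => congrFun (congrFun (hcomm 2) i) j
  have e00 := h0 0 1
  have e01 := h2 0 1
  have e10 := h2 1 0
  simp [pauli, Matrix.mul_apply, Fin.sum_univ_two] at e00 e01 e10
  have k01 : k 0 1 = 0 := self_eq_neg.mp e01.symm
  have k10 : k 1 0 = 0 := self_eq_neg.mp e10
  have hdet : k.det = 1 := by
    have := hg.det
    rwa [hgk, Matrix.det_mul, hh.det, one_mul] at this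
  rw [Matrix.det_fin_two, k01, e00] at hdet
  simp only [zero_mul, sub_zero] at hdet
  have hks : k = !![k 1 1, 0; 0, k 1 1] := by
    rw [Matrix.eta_fin_two k, k01, k10, e00]
    rfl
  rcases mul_self_eq_one_iff.mp hdet with h1 | h1
  · left
    rw [hgk, hks, h1, ← Matrix.one_fin_two, Matrix.mul_one]
  · right
    have : (!![-1, 0; 0, -1] : Matrix (Fin 2) (Fin 2) ℂ) = -1 := by
      rw [Matrix.one_fin_two]; simp
    rw [hgk, hks, h1, this, Matrix.mul_neg, Matrix.mul_one]

theorem isLift_liftZ (α : ℝ) : IsLift (liftZ α) (rotZ (α : Circ)) where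
  unitary := by
    rw [Matrix.one_fin_two, liftZ]
    ext i j
    fin_cases i <;> fin_cases j <;>
      simp [Matrix.mul_apply, Fin.sum_univ_two, ← Complex.exp_conj, ← Complex.exp_add,
        Complex.conj_ofNat]
  det := by simp [liftZ, Matrix.det_fin_two, ← Complex.exp_add]
  intertwine j := by
    -- The full-angle entries of R_z meet the half-angle entries of the lift through e^{-iα/2} =
    -- e^{-iα} e^{iα/2}, and in `e2` through the conjugate identity.
    have e1 : Complex.exp (-((α / 2 : ℝ) : ℂ) * Complex.I) =
        Complex.cos α * Complex.exp ((α / 2 : ℝ) * Complex.I) -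
          Complex.sin α * Complex.I * Complex.exp ((α / 2 : ℝ) * Complex.I) := by
      have : -((α / 2 : ℝ) : ℂ) * Complex.I =
        -(α : ℂ) * Complex.I + (α / 2 : ℝ) * Complex.I := by push_cast; ring
      rw [this, Complex.exp_add, Complex.exp_mul_I, Complex.cos_neg, Complex.sin_neg]
      ring
    have e2 : Complex.exp (((α / 2 : ℝ) : ℂ) * Complex.I) =
        Complex.cos α * Complex.exp (-(α / 2 : ℝ) * Complex.I) +
          Complex.sin α * Complex.I * Complex.exp (-(α / 2 : ℝ) * Complex.I) := by
      have : ((α / 2 : ℝ) : ℂ) * Complex.I =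
        (α : ℂ) * Complex.I + -(α / 2 : ℝ) * Complex.I := by push_cast; ring
      rw [this, Complex.exp_add, Complex.exp_mul_I]
      ring
    simp only [liftZ, rotZ, cosC_coe, sinC_coe]
    generalize Complex.exp (-((α / 2 : ℝ) : ℂ) * Complex.I) = z at *
    generalize Complex.exp (((α / 2 : ℝ) : ℂ) * Complex.I) = w at *
    ext a b
    fin_cases j <;> fin_cases a <;> fin_cases b <;>
      simp [pauli, Matrix.mul_apply, Fin.sum_univ_two, Fin.sum_univ_three]
    · linear_combination e1
    · linear_combination e2
    · linear_combination -Complex.I * e1 + w * Complex.sin α * Complex.I_sq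
    · linear_combination Complex.I * e2 + z * Complex.sin α * Complex.I_sq

theorem isLift_liftY (β : ℝ) : IsLift (liftY β) (rotY (β : Circ)) where
  unitary := by
    have h := Complex.sin_sq_add_cos_sq (β / 2)
    rw [Matrix.one_fin_two, liftY]
    ext i j
    fin_cases i <;> fin_cases j <;>
      simp [Matrix.mul_apply, Fin.sum_univ_two, ← Complex.cos_conj, ← Complex.sin_conj,
        Complex.conj_ofNat]
    · linear_combination h
    · ring
    · ring
    · linear_combination h
  det := by
    have h := Complex.sin_sq_add_cos_sq (β / 2)
    simp [liftY, Matrix.det_fin_two]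
    linear_combination h
  intertwine j := by
    have h := Complex.sin_sq_add_cos_sq (β / 2)
    have hc : Complex.cos β = Complex.cos (β / 2) ^ 2 - Complex.sin (β / 2) ^ 2 := by
      rw [← Complex.cos_two_mul', mul_div_cancel₀ _ two_ne_zero]
    have hs : Complex.sin β = 2 * Complex.sin (β / 2) * Complex.cos (β / 2) := by
      rw [← Complex.sin_two_mul, mul_div_cancel₀ _ two_ne_zero]
    ext a b
    fin_cases j <;> fin_cases a <;> fin_cases b <;>
      simp [pauli, liftY, rotY, cosC_coe, sinC_coe, Matrix.mul_apply, Fin.sum_univ_two,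
        Fin.sum_univ_three, hc, hs] <;> generalize Complex.sin (β / 2) = S at * <;>
        generalize Complex.cos (β / 2) = K at *
    · linear_combination S * h
    · linear_combination -K * h
    · linear_combination -K * h
    · linear_combination -S * h
    · ring
    · ring
    · ring
    · ring
    · linear_combination -K * h
    · linear_combination -S * h
    · linear_combination -S * h
    · linear_combination K * h

/-- The lift of the rotation with Euler angles `α, β, γ`. -/
def liftEuler (α β γ : ℝ) : Matrix (Fin 2) (Fin 2) ℂ := liftZ α * liftY β * liftZ γ

theorem isLift_liftEuler (α β γ : ℝ) :
    IsLift (liftEuler α β γ) (euler (α : Circ) (β : Circ) (γ : Circ)) :=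
  ((isLift_liftZ α).mul (isLift_liftY β)).mul (isLift_liftZ γ)

theorem exists_isLift (R : SO3) : ∃ g, IsLift g R := by
  obtain ⟨⟨α, β, γ⟩, -, h⟩ := exists_euler R
  obtain ⟨α, rfl⟩ := QuotientAddGroup.mk_surjective α
  obtain ⟨γ, rfl⟩ := QuotientAddGroup.mk_surjective γ
  exact ⟨_, h ▸ isLift_liftEuler α β γ⟩

theorem symU_eq_of_isLift {n p q : ℕ} (hp : p ≤ 2 * n) (hq : q ≤ 2 * n)
    {g h : Matrix (Fin 2) (Fin 2) ℂ} {R : SO3} (hg : IsLift g R) (hh : IsLift h R) :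
    symU (2 * n) g p q = symU (2 * n) h p q := by
  rcases hg.eq_or_eq_neg hh with rfl | rfl
  · rfl
  · exact symU_neg (even_two_mul n) hp hq h

theorem symU_liftZ_mul {n : ℕ} {k : ℤ} (hk : |k| ≤ n) {q : ℕ} (hq : q ≤ 2 * n) (α : ℝ)
    (g : Matrix (Fin 2) (Fin 2) ℂ) :
    symU (2 * n) (liftZ α * g) (n + k).toNat q =
      fourier (-k) (α : Circ) * symU (2 * n) g (n + k).toNat q := by
  rw [abs_le] at hk
  rw [liftZ, symU_diag_mul (by omega) hq, ← Complex.exp_nat_mul, ← Complex.exp_nat_mul,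
    ← Complex.exp_add, fourier_coe_apply]
  congr 2
  have h1 : (((n + k).toNat : ℕ) : ℂ) = n + k := by
    have : (((n + k).toNat : ℕ) : ℤ) = n + k := by omega
    exact_mod_cast this
  have h2 : ((2 * n - (n + k).toNat : ℕ) : ℂ) = n - k := by
    have : ((2 * n - (n + k).toNat : ℕ) : ℤ) = n - k := by omega
    exact_mod_cast this
  rw [h1, h2]
  have := Real.pi_ne_zero
  push_cast
  field_simp
  ring

theorem symU_mul_liftZ {n : ℕ} {l : ℤ} (hl : |l| ≤ n) (p : ℕ) (γ : ℝ)
    (g : Matrix (Fin 2) (Fin 2) ℂ) :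
    symU (2 * n) (g * liftZ γ) p (n + l).toNat =
      symU (2 * n) g p (n + l).toNat * fourier (-l) (γ : Circ) := by
  have hl' : (n + l).toNat ≤ 2 * n := by rw [abs_le] at hl; omega
  have e := symU_liftZ_mul hl hl' γ 1
  rw [mul_one, symU_one _ hl', if_pos rfl, mul_one, liftZ, symU_diag _ hl', if_pos rfl] at e
  rw [liftZ, symU_mul_diag p hl', e]

theorem wignerD_eq_symU {n : ℕ} {k l : ℤ} (hk : |k| ≤ n) (hl : |l| ≤ n)
    {g : Matrix (Fin 2) (Fin 2) ℂ} {R : SO3} (hg : IsLift g R) :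
    wignerD n k l R =
      (√(2 * n + 1 : ℝ) : ℂ) * symU (2 * n) g (n + k).toNat (n + l).toNat := by
  obtain ⟨⟨α, β, γ⟩, hβ, h⟩ := exists_euler R
  obtain ⟨α, rfl⟩ := QuotientAddGroup.mk_surjective α
  obtain ⟨γ, rfl⟩ := QuotientAddGroup.mk_surjective γ
  have hk' : (n + k).toNat ≤ 2 * n := by rw [abs_le] at hk; omega
  have hl' : (n + l).toNat ≤ 2 * n := by rw [abs_le] at hl; omega
  rw [symU_eq_of_isLift hk' hl' hg (h ▸ isLift_liftEuler α β γ), ← h, wignerD_euler _ _ _ _ _ _ hβ,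
    wignerDAngles, liftEuler, symU_mul_liftZ hl, symU_liftZ_mul hk hl', wignerd_cos hk hl hβ]
  simp only [mul_assoc]

/-! ### Fourier series of the Wigner functions -/

theorem sum_range_eq_sum_Icc {M : Type*} [AddCommMonoid M] (n : ℕ) (F : ℕ → M) :
    ∑ p ∈ Finset.range (2 * n + 1), F p = ∑ k ∈ Finset.Icc (-(n : ℤ)) n, F (n + k).toNat := by
  symm
  refine Finset.sum_bij' (fun k _ => (n + k).toNat) (fun p _ => (p : ℤ) - n) ?_ ?_ ?_ ?_ ?_
  · intro k hk; rw [Finset.mem_Icc] at hk; rw [Finset.mem_range]; omega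
  · intro p hp; rw [Finset.mem_range] at hp; rw [Finset.mem_Icc]; omega
  · intro k hk; rw [Finset.mem_Icc] at hk; omega
  · intro p hp; omega
  · intro k hk; rfl

theorem mem_Icc_iff_abs_le {n : ℕ} {k : ℤ} : k ∈ Finset.Icc (-(n : ℤ)) n ↔ |k| ≤ n := by
  rw [Finset.mem_Icc, abs_le]

theorem toNat_add_le {n : ℕ} {k : ℤ} (hk : |k| ≤ n) : (n + k).toNat ≤ 2 * n := by
  rw [abs_le] at hk; omega

theorem fourier_pi_div_two (m : ℤ) : (fourier m ((Real.pi / 2 : ℝ) : Circ) : ℂ) = Complex.I ^ m := by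
  rw [fourier_coe_apply]
  trans Complex.exp (m * (Real.pi / 2 * Complex.I))
  swap
  · rw [Complex.exp_int_mul, Complex.exp_pi_div_two_mul_I]
  congr 1
  have := Real.pi_ne_zero
  push_cast
  field_simp

theorem fourier_neg_pi_div_two (m : ℤ) :
    (fourier m ((-(Real.pi / 2) : ℝ) : Circ) : ℂ) = Complex.I ^ (-m) := by
  rw [← fourier_pi_div_two, ← fourier_angle_neg]
  rfl

/-- The quarter turn about y carries the z-axis to the x-axis, and the one about z carries that to
the y-axis. The point is that β now occurs only in a diagonal factor. -/
theorem liftY_eq_conj_liftZ (β : ℝ) :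
    liftY β = liftZ (Real.pi / 2) * (liftY (Real.pi / 2) * (liftZ β * liftY (-(Real.pi / 2))) *
      liftZ (-(Real.pi / 2))) := by
  have hs : Real.sin (Real.pi / 2 / 2) = √2 / 2 := by
    rw [div_div]; norm_num
  have hc : Real.cos (Real.pi / 2 / 2) = √2 / 2 := by
    rw [div_div]; norm_num
  have hr : (√2 : ℂ) * √2 = 2 := by exact_mod_cast Real.mul_self_sqrt (by norm_num : (0 : ℝ) ≤ 2)
  set z := Complex.exp (-((Real.pi / 2 / 2 : ℝ) : ℂ) * Complex.I) with hz
  set w := Complex.exp (((Real.pi / 2 / 2 : ℝ) : ℂ) * Complex.I) with hw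
  have hzw : z * w = 1 := by rw [hz, hw, ← Complex.exp_add]; simp
  have hww : w * w = Complex.I := by
    rw [hw, ← Complex.exp_add]
    refine Eq.trans (congrArg Complex.exp ?_) Complex.exp_pi_div_two_mul_I
    push_cast; ring
  have hzz : z * z = -Complex.I := by
    rw [hz, ← Complex.exp_add]
    refine Eq.trans (congrArg Complex.exp ?_) Complex.exp_neg_pi_div_two_mul_I
    push_cast; ring
  have hu : Complex.exp (-((β / 2 : ℝ) : ℂ) * Complex.I) =
      Complex.cos (β / 2) - Complex.sin (β / 2) * Complex.I := by
    rw [Complex.exp_mul_I, Complex.cos_neg, Complex.sin_neg]; push_cast; ring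
  have hv : Complex.exp (((β / 2 : ℝ) : ℂ) * Complex.I) =
      Complex.cos (β / 2) + Complex.sin (β / 2) * Complex.I := by
    rw [Complex.exp_mul_I]; push_cast; ring
  have e1 : liftZ (Real.pi / 2) = !![z, 0; 0, w] := rfl
  have e2 : liftZ (-(Real.pi / 2)) = !![w, 0; 0, z] := by
    rw [liftZ, neg_div]; push_cast [hz, hw]; simp
  have e3 : liftY (Real.pi / 2) = !![(√2 / 2 : ℂ), -(√2 / 2 : ℂ); (√2 / 2 : ℂ), (√2 / 2 : ℂ)] := by
    rw [liftY, hs, hc]; push_cast; rfl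
  have e4 : liftY (-(Real.pi / 2)) =
      !![(√2 / 2 : ℂ), (√2 / 2 : ℂ); -(√2 / 2 : ℂ), (√2 / 2 : ℂ)] := by
    rw [liftY, neg_div, Real.sin_neg, Real.cos_neg, hs, hc]; push_cast; simp
  rw [e1, e2, e3, e4, liftZ, hu, hv]
  clear_value z w
  have hI := Complex.I_sq
  ext i j
  fin_cases i <;> fin_cases j <;> simp [liftY, Matrix.mul_apply, Fin.sum_univ_two] <;>
    generalize Complex.sin (β / 2) = S <;> generalize Complex.cos (β / 2) = K <;>
    generalize (√2 : ℂ) = r at *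
  · linear_combination -K * hzw - (z * w) * K / 2 * hr
  · linear_combination -S * hI + S * Complex.I * hzz + z * z * S * Complex.I / 2 * hr
  · linear_combination S * hI + S * Complex.I * hww + w * w * S * Complex.I / 2 * hr
  · linear_combination -K * hzw - (z * w) * K / 2 * hr

theorem symU_liftY_eq_sum {n : ℕ} {k l : ℤ} (hk : |k| ≤ n) (hl : |l| ≤ n) (β : ℝ) :
    symU (2 * n) (liftY β) (n + k).toNat (n + l).toNat =
      Complex.I ^ (k - l) * ∑ j ∈ Finset.Icc (-(n : ℤ)) n,
        (wignerd n j k 0 : ℂ) * (wignerd n j l 0 : ℂ) * fourier (-j) (β : Circ) := by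
  have hπ : Real.pi / 2 ∈ Set.Icc 0 Real.pi := ⟨by positivity, by linarith [Real.pi_pos]⟩
  have hd : ∀ {j k : ℤ}, |j| ≤ n → |k| ≤ n → (wignerd n j k 0 : ℂ) =
      symU (2 * n) (liftY (Real.pi / 2)) (n + j).toNat (n + k).toNat := by
    intro j k hj hk
    rw [← Real.cos_pi_div_two, wignerd_cos hj hk hπ]
  have hp := toNat_add_le hk
  have hq := toNat_add_le hl
  rw [liftY_eq_conj_liftZ, symU_liftZ_mul hk hq, symU_mul_liftZ hl, symU_mul _ hq,
    sum_range_eq_sum_Icc, Finset.mul_sum, Finset.sum_mul, Finset.mul_sum]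
  refine Finset.sum_congr rfl fun j hj => ?_
  rw [mem_Icc_iff_abs_le] at hj
  have hjn := toNat_add_le hj
  rw [symU_liftZ_mul hj hq, symU_liftY_neg (even_two_mul n) hjn hq,
    symU_liftY_swap (even_two_mul n) hjn hp, hd hj hk, hd hj hl, fourier_pi_div_two,
    fourier_neg_pi_div_two, neg_one_pow_toNat_add hj hk, neg_one_pow_toNat_add hj hl]
  -- The outer quarter turns about z contribute i^{-k} and i^{l}. The two signs come from exchanging
  -- the indices of the first quarter-turn factor about y and from the negative angle in the second;
  -- the dependence on j cancels because i⁴ = 1.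
  have hI : Complex.I ^ (-k) * (-1) ^ (j + k) * (-1) ^ (j + l) * Complex.I ^ (- -l) =
      Complex.I ^ (k - l) := by
    have h0 := Complex.I_ne_zero
    have h1 : (-1 : ℂ) = Complex.I ^ (2 : ℤ) := by
      rw [show (2 : ℤ) = ((2 : ℕ) : ℤ) by rfl, zpow_natCast, Complex.I_sq]
    have h4 : Complex.I ^ (4 * (j + l)) = 1 := by
      rw [zpow_mul, show (4 : ℤ) = ((4 : ℕ) : ℤ) by rfl, zpow_natCast, Complex.I_pow_four, one_zpow]
    rw [h1, ← zpow_mul, ← zpow_mul, ← zpow_add₀ h0, ← zpow_add₀ h0, ← zpow_add₀ h0,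
      show -k + 2 * (j + k) + 2 * (j + l) + - -l = (k - l) + 4 * (j + l) by ring, zpow_add₀ h0, h4,
      mul_one]
  rw [← hI]
  ring

theorem torusChar_vec (k j l : ℤ) (x : Torus3) :
    torusChar ![k, j, l] x = fourier k (x 0) * fourier j (x 1) * fourier l (x 2) := by
  simp [torusChar, Fin.prod_univ_three]

/-- No restriction to β ∈ [0, π] is needed, because `liftEuler` lifts the rotation for every real β.
The indices are negated so that the characters carry positive exponents k and l. -/
theorem wignerD_phiSO3 {n : ℕ} {k l : ℤ} (hk : |k| ≤ n) (hl : |l| ≤ n) (x : Torus3) :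
    wignerD n (-k) (-l) (phiSO3 x) =
      ∑ j ∈ Finset.Icc (-(n : ℤ)) n, Complex.I ^ (k - l) *
        ((√(2 * n + 1 : ℝ) * wignerd n j k 0 * wignerd n j l 0 : ℝ) : ℂ) *
          torusChar ![k, j, l] x := by
  obtain ⟨α, hα⟩ := QuotientAddGroup.mk_surjective (x 0)
  obtain ⟨β, hβ⟩ := QuotientAddGroup.mk_surjective (x 1)
  obtain ⟨γ, hγ⟩ := QuotientAddGroup.mk_surjective (x 2)
  have hk' : |-k| ≤ n := by rwa [abs_neg]
  have hl' : |-l| ≤ n := by rwa [abs_neg]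
  have hlift : IsLift (liftEuler α β γ) (phiSO3 x) := by
    rw [phiSO3, ← hα, ← hβ, ← hγ]; exact isLift_liftEuler α β γ
  -- Reversing both indices amounts to β ↦ -β, which turns e^{-ijβ} into e^{ijβ}.
  have hrev : symU (2 * n) (liftY β) (n + -k).toNat (n + -l).toNat =
      symU (2 * n) (liftY (-β)) (n + k).toNat (n + l).toNat := by
    rw [symU_liftY_neg (even_two_mul n) (toNat_add_le hk) (toNat_add_le hl),
      ← symU_liftY_reverse (even_two_mul n) (toNat_add_le hk) (toNat_add_le hl)]
    rw [abs_le] at hk hl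
    congr 1 <;> omega
  rw [wignerD_eq_symU hk' hl' hlift, liftEuler, symU_mul_liftZ hl',
    symU_liftZ_mul hk' (toNat_add_le hl'), hrev, symU_liftY_eq_sum hk hl, neg_neg, neg_neg]
  simp only [Finset.mul_sum, Finset.sum_mul]
  refine Finset.sum_congr rfl fun j _ => ?_
  have hj : (fourier (-j) ((-β : ℝ) : Circ) : ℂ) = fourier j (x 1) := by
    rw [show ((-β : ℝ) : Circ) = -(β : Circ) from rfl, fourier_angle_neg, neg_neg, ← hβ]
  have ha : (fourier k (α : Circ) : ℂ) = fourier k (x 0) := by rw [← hα]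
  have hg : (fourier l (γ : Circ) : ℂ) = fourier l (x 2) := by rw [← hγ]
  rw [torusChar_vec, hj, ha, hg]
  push_cast
  ring

/-! ### Continuity -/

theorem continuous_cosC : Continuous cosC := Real.Angle.continuous_cos

theorem continuous_sinC : Continuous sinC := Real.Angle.continuous_sin

theorem continuous_rotZ : Continuous rotZ := by
  refine Continuous.subtype_mk ?_ _
  refine continuous_matrix fun i j => ?_
  have := continuous_cosC
  have := continuous_sinC
  fin_cases i <;> fin_cases j <;> simp <;> fun_prop

theorem continuous_rotY : Continuous rotY := by
  refine Continuous.subtype_mk ?_ _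
  refine continuous_matrix fun i j => ?_
  have := continuous_cosC
  have := continuous_sinC
  fin_cases i <;> fin_cases j <;> simp <;> fun_prop

theorem continuous_phiSO3 : Continuous phiSO3 :=
  ((continuous_rotZ.comp (continuous_apply 0)).mul
    (continuous_rotY.comp (continuous_apply 1))).mul (continuous_rotZ.comp (continuous_apply 2))

theorem phiSO3_surjective : Function.Surjective phiSO3 := by
  intro R
  obtain ⟨p, -, h⟩ := exists_euler R
  exact ⟨![p.1, (p.2.1 : ℝ), p.2.2], h⟩

theorem isQuotientMap_phiSO3 : Topology.IsQuotientMap phiSO3 :=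
  continuous_phiSO3.isClosedMap.isQuotientMap continuous_phiSO3 phiSO3_surjective

theorem continuous_torusChar (m : Fin 3 → ℤ) : Continuous (torusChar m) :=
  continuous_finsetProd _ fun i _ => (fourier (m i)).continuous.comp (continuous_apply i)

/-- The chosen Euler angles need not depend continuously on the rotation. Continuity is instead
tested on the torus, through the quotient map `phiSO3`, where the function is a trigonometric
polynomial. -/
theorem continuous_wignerD {n : ℕ} {k l : ℤ} (hk : |k| ≤ n) (hl : |l| ≤ n) :
    Continuous (wignerD n k l) := by
  rw [isQuotientMap_phiSO3.continuous_iff]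
  have hk' : |-k| ≤ n := by rwa [abs_neg]
  have hl' : |-l| ≤ n := by rwa [abs_neg]
  have e := funext (wignerD_phiSO3 hk' hl')
  simp only [neg_neg] at e
  refine Eq.mpr (congrArg Continuous e) ?_
  exact continuous_finsetSum _ fun j _ => continuous_const.mul (continuous_torusChar _)

/-! ### The unitary matrix coefficients and their orthogonality relations -/

/-- The unitary matrix coefficient `D_n^{k,l} / √(2n+1)`. -/
def matCoeff (n : ℕ) (k l : ℤ) (R : SO3) : ℂ :=
  symU (2 * n) (exists_isLift R).choose (n + k).toNat (n + l).toNat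

theorem wignerD_eq_matCoeff {n : ℕ} {k l : ℤ} (hk : |k| ≤ n) (hl : |l| ≤ n) (R : SO3) :
    wignerD n k l R = (√(2 * n + 1 : ℝ) : ℂ) * matCoeff n k l R :=
  wignerD_eq_symU hk hl (exists_isLift R).choose_spec

theorem matCoeff_of_isLift {n : ℕ} {k l : ℤ} (hk : |k| ≤ n) (hl : |l| ≤ n)
    {g : Matrix (Fin 2) (Fin 2) ℂ} {R : SO3} (hg : IsLift g R) :
    matCoeff n k l R = symU (2 * n) g (n + k).toNat (n + l).toNat :=
  symU_eq_of_isLift (toNat_add_le hk) (toNat_add_le hl) (exists_isLift R).choose_spec hg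

theorem continuous_matCoeff {n : ℕ} {k l : ℤ} (hk : |k| ≤ n) (hl : |l| ≤ n) :
    Continuous (matCoeff n k l) := by
  have h0 : (√(2 * n + 1 : ℝ) : ℂ) ≠ 0 := by
    exact_mod_cast (Real.sqrt_pos.mpr (by positivity)).ne'
  have e : matCoeff n k l = fun R => (√(2 * n + 1 : ℝ) : ℂ)⁻¹ * wignerD n k l R := by
    funext R
    rw [wignerD_eq_matCoeff hk hl, inv_mul_cancel_left₀ h0]
  rw [e]
  exact continuous_const.mul (continuous_wignerD hk hl)

theorem matCoeff_mul {n : ℕ} {k l : ℤ} (hk : |k| ≤ n) (hl : |l| ≤ n) (R S : SO3) :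
    matCoeff n k l (R * S) =
      ∑ a ∈ Finset.Icc (-(n : ℤ)) n, matCoeff n k a R * matCoeff n a l S := by
  obtain ⟨g, hg⟩ := exists_isLift R
  obtain ⟨h, hh⟩ := exists_isLift S
  rw [matCoeff_of_isLift hk hl (hg.mul hh), symU_mul _ (toNat_add_le hl), sum_range_eq_sum_Icc]
  refine Finset.sum_congr rfl fun a ha => ?_
  rw [mem_Icc_iff_abs_le] at ha
  rw [matCoeff_of_isLift hk ha hg, matCoeff_of_isLift ha hl hh]

theorem matCoeff_unitary {n : ℕ} {l l' : ℤ} (hl : |l| ≤ n) (hl' : |l'| ≤ n) (R : SO3) :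
    ∑ k ∈ Finset.Icc (-(n : ℤ)) n, matCoeff n k l' R * (starRingEnd ℂ) (matCoeff n k l R) =
      if l = l' then 1 else 0 := by
  obtain ⟨g, hg⟩ := exists_isLift R
  have h := symU_unitary (toNat_add_le hl) (toNat_add_le hl') hg.unitary
  rw [sum_range_eq_sum_Icc] at h
  have e : ((n + l).toNat = (n + l').toNat) = (l = l') := by
    rw [abs_le] at hl hl'
    exact propext ⟨fun _ => by omega, fun _ => by omega⟩
  simp only [e] at h
  rw [← h]
  refine Finset.sum_congr rfl fun k hk => ?_
  rw [mem_Icc_iff_abs_le] at hk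
  rw [matCoeff_of_isLift hk hl hg, matCoeff_of_isLift hk hl' hg]

theorem matCoeff_rotZ_mul {n : ℕ} {k l : ℤ} (hk : |k| ≤ n) (hl : |l| ≤ n) (α : ℝ) (R : SO3) :
    matCoeff n k l (rotZ (α : Circ) * R) = fourier (-k) (α : Circ) * matCoeff n k l R := by
  obtain ⟨g, hg⟩ := exists_isLift R
  rw [matCoeff_of_isLift hk hl ((isLift_liftZ α).mul hg), symU_liftZ_mul hk (toNat_add_le hl),
    matCoeff_of_isLift hk hl hg]

/-- In the row k = n the parameter s is 0, so the Jacobi sum has one term and the entry is a nonzero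
multiple of a product of powers of sin(π/4) and cos(π/4). This nonvanishing replaces irreducibility
in the Schur argument. -/
theorem matCoeff_top_ne_zero {n : ℕ} {l : ℤ} (hl : |l| ≤ n) :
    matCoeff n n l (rotY ((Real.pi / 2 : ℝ) : Circ)) ≠ 0 := by
  have hn : |(n : ℤ)| ≤ n := by rw [abs_of_nonneg (Int.natCast_nonneg n)]
  rw [matCoeff_of_isLift hn hl (isLift_liftY _)]
  have hq := toNat_add_le hl
  obtain ⟨a, ha⟩ := Nat.exists_eq_add_of_le hq
  have hs : Real.sin (Real.pi / 2 / 2) ≠ 0 := by rw [div_div]; norm_num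
  have hc : Real.cos (Real.pi / 2 / 2) ≠ 0 := by rw [div_div]; norm_num
  have e := symCoeff_liftY 0 a (n + l).toNat (Real.pi / 2)
  rw [show 2 * 0 + a + (n + l).toNat = 2 * n by omega,
    zero_add (n + l).toNat] at e
  rw [show ((n : ℤ) + n).toNat = 2 * n by omega]
  refine mul_ne_zero ?_ ?_
  · exact_mod_cast (div_pos (sqrt_choose_pos hq) (sqrt_choose_pos le_rfl)).ne'
  · rw [e]
    norm_cast
    simp [hs, hc]

/-! ### Haar measure and Schur orthogonality. -/

instance : IsProbabilityMeasure haarSO3 :=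
  ⟨by simpa [haarSO3] using Measure.haarMeasure_self (G := SO3) (K₀ := ⊤)⟩

instance : haarSO3.IsMulLeftInvariant := by
  unfold haarSO3; infer_instance

theorem integrable_of_continuous {f : SO3 → ℂ} (hf : Continuous f) : Integrable f haarSO3 :=
  hf.integrable_of_hasCompactSupport (HasCompactSupport.of_compactSpace f)

/-- The inner product of two matrix coefficients. -/
def gram (n n' : ℕ) (l l' k k' : ℤ) : ℂ :=
  ∫ R, matCoeff n k l R * (starRingEnd ℂ) (matCoeff n' k' l' R) ∂haarSO3

theorem integrable_matCoeff_mul {n n' : ℕ} {l l' k k' : ℤ} (hl : |l| ≤ n) (hl' : |l'| ≤ n')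
    (hk : |k| ≤ n) (hk' : |k'| ≤ n') :
    Integrable (fun R => matCoeff n k l R * (starRingEnd ℂ) (matCoeff n' k' l' R)) haarSO3 :=
  integrable_of_continuous ((continuous_matCoeff hk hl).mul
    (Complex.continuous_conj.comp (continuous_matCoeff hk' hl')))

theorem gram_translate (n n' : ℕ) (l l' k k' : ℤ) (S : SO3) :
    gram n n' l l' k k' =
      ∫ R, matCoeff n k l (S * R) * (starRingEnd ℂ) (matCoeff n' k' l' (S * R)) ∂haarSO3 :=
  (integral_mul_left_eq_self
    (fun R => matCoeff n k l R * (starRingEnd ℂ) (matCoeff n' k' l' R)) S).symm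

theorem gram_eq_zero_of_ne {n n' : ℕ} {l l' k k' : ℤ} (hl : |l| ≤ n) (hl' : |l'| ≤ n')
    (hk : |k| ≤ n) (hk' : |k'| ≤ n') (hne : k ≠ k') : gram n n' l l' k k' = 0 := by
  have hd : ((k - k' : ℤ) : ℝ) ≠ 0 := by exact_mod_cast sub_ne_zero.mpr hne
  -- Translation by R_z(α) multiplies the integral by e^{-i(k-k')α}; this α makes the factor -1.
  set α : ℝ := Real.pi / (k - k' : ℤ) with hα
  have h := gram_translate n n' l l' k k' (rotZ (α : Circ))
  simp only [matCoeff_rotZ_mul hk hl, matCoeff_rotZ_mul hk' hl', map_mul] at h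
  have e : (fourier (-k) (α : Circ) : ℂ) * (starRingEnd ℂ) (fourier (-k') (α : Circ) : ℂ) = -1 := by
    rw [← fourier_neg, neg_neg, ← fourier_add, fourier_coe_apply]
    trans Complex.exp (-(Real.pi * Complex.I))
    · congr 1
      have := Real.pi_ne_zero
      have hd' : ((k - k' : ℤ) : ℂ) ≠ 0 := by exact_mod_cast sub_ne_zero.mpr hne
      rw [hα]
      push_cast at hd' ⊢
      field_simp
      ring
    · rw [Complex.exp_neg, Complex.exp_pi_mul_I]; norm_num
  have h2 : gram n n' l l' k k' = -1 * gram n n' l l' k k' := by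
    conv_lhs => rw [h]
    rw [gram, ← integral_const_mul, ← e]
    congr 1
    funext R
    ring
  linear_combination h2 / 2

/-- Left invariance gives G = T(S) G T'(S)*, where G is the matrix of inner products in k, k' and T,
T' are the two representations. Unitarity of T'(S) moves it to the other side. -/
theorem gram_intertwine {n n' : ℕ} {l l' k c : ℤ} (hl : |l| ≤ n) (hl' : |l'| ≤ n')
    (hk : |k| ≤ n) (hc : |c| ≤ n') (S : SO3) :
    ∑ k' ∈ Finset.Icc (-(n' : ℤ)) n', gram n n' l l' k k' * matCoeff n' k' c S =
      ∑ a ∈ Finset.Icc (-(n : ℤ)) n, matCoeff n k a S * gram n n' l l' a c := by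
  have h1 : ∀ k' ∈ Finset.Icc (-(n' : ℤ)) n', gram n n' l l' k k' =
      ∑ a ∈ Finset.Icc (-(n : ℤ)) n, ∑ b ∈ Finset.Icc (-(n' : ℤ)) n',
        matCoeff n k a S * (starRingEnd ℂ) (matCoeff n' k' b S) * gram n n' l l' a b := by
    intro k' hk'
    rw [mem_Icc_iff_abs_le] at hk'
    rw [gram_translate n n' l l' k k' S]
    have e : ∀ R, matCoeff n k l (S * R) * (starRingEnd ℂ) (matCoeff n' k' l' (S * R)) =
        ∑ a ∈ Finset.Icc (-(n : ℤ)) n, ∑ b ∈ Finset.Icc (-(n' : ℤ)) n',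
          matCoeff n k a S * (starRingEnd ℂ) (matCoeff n' k' b S) *
            (matCoeff n a l R * (starRingEnd ℂ) (matCoeff n' b l' R)) := by
      intro R
      rw [matCoeff_mul hk hl, matCoeff_mul hk' hl', map_sum, Finset.sum_mul_sum]
      refine Finset.sum_congr rfl fun a _ => Finset.sum_congr rfl fun b _ => ?_
      rw [map_mul]
      ring
    simp only [e]
    have hint : ∀ a ∈ Finset.Icc (-(n : ℤ)) n, ∀ b ∈ Finset.Icc (-(n' : ℤ)) n',
        Integrable (fun R => matCoeff n k a S * (starRingEnd ℂ) (matCoeff n' k' b S) *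
            (matCoeff n a l R * (starRingEnd ℂ) (matCoeff n' b l' R))) haarSO3 :=
      fun a ha b hb => (integrable_matCoeff_mul hl hl' (mem_Icc_iff_abs_le.mp ha)
        (mem_Icc_iff_abs_le.mp hb)).const_mul _
    rw [integral_finsetSum _ fun a ha => integrable_finsetSum _ (hint a ha)]
    refine Finset.sum_congr rfl fun a ha => ?_
    rw [integral_finsetSum _ (hint a ha)]
    refine Finset.sum_congr rfl fun b _ => ?_
    rw [integral_const_mul, gram]
  rw [Finset.sum_congr rfl fun k' hk' => by rw [h1 k' hk']]
  simp only [Finset.sum_mul]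
  rw [Finset.sum_comm]
  refine Finset.sum_congr rfl fun a _ => ?_
  rw [Finset.sum_comm]
  have h2 : ∀ b ∈ Finset.Icc (-(n' : ℤ)) n', (∑ k' ∈ Finset.Icc (-(n' : ℤ)) n',
      matCoeff n k a S * (starRingEnd ℂ) (matCoeff n' k' b S) * gram n n' l l' a b *
        matCoeff n' k' c S) =
      matCoeff n k a S * gram n n' l l' a b * if b = c then 1 else 0 := by
    intro b hb
    rw [← matCoeff_unitary (mem_Icc_iff_abs_le.mp hb) hc S, Finset.mul_sum]
    exact Finset.sum_congr rfl fun _ _ => by ring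
  rw [Finset.sum_congr rfl h2]
  simp only [mul_ite, mul_one, mul_zero, Finset.sum_ite_eq']
  rw [if_pos (mem_Icc_iff_abs_le.mpr hc)]

theorem gram_eq_zero_of_lt {n n' : ℕ} (hlt : n' < n) {l l' : ℤ} (hl : |l| ≤ n) (hl' : |l'| ≤ n')
    (c : ℤ) (hc : |c| ≤ n') : gram n n' l l' c c = 0 := by
  have hn : |(n : ℤ)| ≤ n := by rw [abs_of_nonneg (Int.natCast_nonneg n)]
  have hcn : |c| ≤ n := hc.trans (by exact_mod_cast hlt.le)
  have h := gram_intertwine hl hl' hn hc (rotY ((Real.pi / 2 : ℝ) : Circ))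
  -- G is diagonal, and n' < n leaves no index k' = n, so the left side vanishes; on the right only
  -- a = c remains.
  rw [Finset.sum_eq_zero, Finset.sum_eq_single c] at h
  · exact (mul_eq_zero.mp h.symm).resolve_left (matCoeff_top_ne_zero hcn)
  · intro a ha hne
    rw [gram_eq_zero_of_ne hl hl' (mem_Icc_iff_abs_le.mp ha) hc hne, mul_zero]
  · exact fun h => absurd (mem_Icc_iff_abs_le.mpr hcn) h
  · intro k' hk'
    rw [Finset.mem_Icc] at hk'
    rw [gram_eq_zero_of_ne hl hl' hn (abs_le.mpr hk') (by omega), zero_mul]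

theorem gram_conj (n n' : ℕ) (l l' k k' : ℤ) :
    gram n' n l' l k' k = (starRingEnd ℂ) (gram n n' l l' k k') := by
  rw [gram, gram, ← integral_conj]
  simp only [map_mul, Complex.conj_conj, mul_comm]

theorem gram_diag_eq {n : ℕ} {l l' c : ℤ} (hl : |l| ≤ n) (hl' : |l'| ≤ n) (hc : |c| ≤ n) :
    gram n n l l' c c = gram n n l l' n n := by
  have hn : |(n : ℤ)| ≤ n := by rw [abs_of_nonneg (Int.natCast_nonneg n)]
  have h := gram_intertwine hl hl' hn hc (rotY ((Real.pi / 2 : ℝ) : Circ))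
  rw [Finset.sum_eq_single (n : ℤ), Finset.sum_eq_single c] at h
  · rw [mul_comm] at h
    exact (mul_left_cancel₀ (matCoeff_top_ne_zero hc) h).symm
  · intro a ha hne
    rw [gram_eq_zero_of_ne hl hl' (mem_Icc_iff_abs_le.mp ha) hc hne, mul_zero]
  · exact fun h => absurd (mem_Icc_iff_abs_le.mpr hc) h
  · intro k' hk' hne
    rw [gram_eq_zero_of_ne hl hl' hn (mem_Icc_iff_abs_le.mp hk') hne.symm, zero_mul]
  · exact fun h => absurd (mem_Icc_iff_abs_le.mpr hn) h

/-- The diagonal entries agree, so 2n + 1 times one of them is the trace, and column orthonormality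
evaluates the trace under the integral sign. -/
theorem gram_diag {n : ℕ} {l l' c : ℤ} (hl : |l| ≤ n) (hl' : |l'| ≤ n) (hc : |c| ≤ n) :
    (2 * n + 1 : ℂ) * gram n n l l' c c = if l' = l then 1 else 0 := by
  have h : ∑ k ∈ Finset.Icc (-(n : ℤ)) n, gram n n l l' k k = if l' = l then 1 else 0 := by
    simp only [gram]
    rw [← integral_finsetSum _ fun k hk => integrable_matCoeff_mul hl hl'
      (mem_Icc_iff_abs_le.mp hk) (mem_Icc_iff_abs_le.mp hk)]
    simp only [matCoeff_unitary hl' hl]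
    simp
  rw [← h, Finset.sum_congr rfl fun k hk => gram_diag_eq hl hl' (mem_Icc_iff_abs_le.mp hk),
    gram_diag_eq hl hl' hc, Finset.sum_const, Int.card_Icc, nsmul_eq_mul]
  rw [show ((n : ℤ) + 1 - -n).toNat = 2 * n + 1 by omega]
  push_cast
  rfl

theorem gram_eq_ite {n n' : ℕ} {l l' k k' : ℤ} (hl : |l| ≤ n) (hl' : |l'| ≤ n')
    (hk : |k| ≤ n) (hk' : |k'| ≤ n') :
    (2 * n + 1 : ℂ) * gram n n' l l' k k' = if n = n' ∧ k = k' ∧ l = l' then 1 else 0 := by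
  rcases eq_or_ne k k' with rfl | hne
  · rcases lt_trichotomy n n' with h | rfl | h
    · rw [gram_conj n' n, gram_eq_zero_of_lt h hl' hl k hk, if_neg (fun e => h.ne e.1)]
      simp
    · rw [gram_diag hl hl' hk]
      simp [eq_comm]
    · rw [gram_eq_zero_of_lt h hl hl' k hk', if_neg (fun e => h.ne' e.1), mul_zero]
  · rw [gram_eq_zero_of_ne hl hl' hk hk' hne, if_neg (fun e => hne e.2.1), mul_zero]

/-- The Wigner-D functions are orthonormal. -/
theorem integral_wignerD_mul_conj {n n' : ℕ} {l l' k k' : ℤ} (hl : |l| ≤ n) (hl' : |l'| ≤ n')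
    (hk : |k| ≤ n) (hk' : |k'| ≤ n') :
    ∫ R, wignerD n k l R * (starRingEnd ℂ) (wignerD n' k' l' R) ∂haarSO3 =
      if n = n' ∧ k = k' ∧ l = l' then 1 else 0 := by
  have e : ∀ R, wignerD n k l R * (starRingEnd ℂ) (wignerD n' k' l' R) =
      ((√(2 * n + 1 : ℝ) : ℂ) * (√(2 * n' + 1 : ℝ) : ℂ)) *
        (matCoeff n k l R * (starRingEnd ℂ) (matCoeff n' k' l' R)) := by
    intro R
    rw [wignerD_eq_matCoeff hk hl, wignerD_eq_matCoeff hk' hl', map_mul, Complex.conj_ofReal]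
    ring
  simp only [e]
  rw [integral_const_mul, ← gram]
  have h := gram_eq_ite hl hl' hk hk'
  rcases eq_or_ne n n' with rfl | hne
  · have hs : (√(2 * n + 1 : ℝ) : ℂ) * (√(2 * n + 1 : ℝ) : ℂ) = 2 * n + 1 := by
      exact_mod_cast Real.mul_self_sqrt (by positivity : (0 : ℝ) ≤ 2 * n + 1)
    rw [hs, h]
  · rw [if_neg (fun e => hne e.1)] at h ⊢
    have h0 : (2 * n + 1 : ℂ) ≠ 0 := by exact_mod_cast (Nat.succ_ne_zero (2 * n))
    rw [(mul_eq_zero.mp h).resolve_left h0, mul_zero]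

/-! ### Fourier coefficients on the torus -/

theorem torusChar_mul (m m' : Fin 3 → ℤ) (x : Torus3) :
    torusChar m x * torusChar m' x = torusChar (m + m') x := by
  simp [torusChar, ← Finset.prod_mul_distrib]

theorem integral_fourier_haar (k : ℤ) :
    ∫ t : Circ, (fourier k t : ℂ) ∂AddCircle.haarAddCircle = if k = 0 then 1 else 0 := by
  -- The mean of a character is its Fourier coefficient of index 0.
  have h := congrFun (fourierCoeff_fourier (T := 2 * Real.pi) k) 0
  simpa [fourierCoeff, Pi.single_apply, eq_comm] using h

theorem integral_torusChar (m : Fin 3 → ℤ) :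
    ∫ x, torusChar m x ∂(Measure.pi fun _ : Fin 3 => AddCircle.haarAddCircle) =
      if m = 0 then 1 else 0 := by
  simp only [torusChar]
  rw [integral_fintype_prod_eq_prod (f := fun i (t : Circ) => (fourier (m i) t : ℂ))]
  simp only [integral_fourier_haar]
  rw [Finset.prod_ite_zero]
  simp [funext_iff]

theorem torusFourierCoeff_torusSynthesis (N : ℕ) (c : (Fin 3 → ℤ) → ℂ) (m : Fin 3 → ℤ) :
    torusFourierCoeff (torusSynthesis N c) m = if ∀ i, |m i| ≤ (N : ℤ) then c m else 0 := by
  have e : ∀ x, torusSynthesis N c x * torusChar (-m) x =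
      ∑ k ∈ Finset.Icc (-(N : ℤ)) N, ∑ j ∈ Finset.Icc (-(N : ℤ)) N,
        ∑ l ∈ Finset.Icc (-(N : ℤ)) N, c ![k, j, l] * torusChar (![k, j, l] + -m) x := by
    intro x
    simp only [torusSynthesis, Finset.sum_mul, mul_assoc, torusChar_mul]
  have hint : ∀ k j l : ℤ, Integrable (fun x => c ![k, j, l] * torusChar (![k, j, l] + -m) x)
      (Measure.pi fun _ : Fin 3 => AddCircle.haarAddCircle) := fun k j l =>
    ((continuous_torusChar _).integrable_of_hasCompactSupport
      (HasCompactSupport.of_compactSpace _)).const_mul _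
  simp only [torusFourierCoeff, e]
  rw [integral_finsetSum _ fun k _ => integrable_finsetSum _ fun j _ =>
    integrable_finsetSum _ fun l _ => hint k j l]
  simp_rw [integral_finsetSum _ fun j _ => integrable_finsetSum _ fun l _ => hint _ j l,
    integral_finsetSum _ fun l _ => hint _ _ l, integral_const_mul, integral_torusChar]
  have hm : ∀ k j l : ℤ, (![k, j, l] + -m = 0) = (k = m 0 ∧ j = m 1 ∧ l = m 2) := by
    intro k j l
    rw [add_neg_eq_zero, funext_iff, Fin.forall_fin_succ, Fin.forall_fin_two]
    rfl
  simp only [hm, ite_and, mul_ite, mul_one, mul_zero, Finset.sum_ite_eq',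
    Finset.sum_ite_irrel, Finset.sum_const_zero]
  have hv : ![m 0, m 1, m 2] = m := by ext i; fin_cases i <;> rfl
  have hall : (∀ i, |m i| ≤ (N : ℤ)) ↔ |m 0| ≤ N ∧ |m 1| ≤ N ∧ |m 2| ≤ N := by
    rw [Fin.forall_fin_succ, Fin.forall_fin_two]
    rfl
  simp only [hv, mem_Icc_iff_abs_le, hall, ite_and]

theorem torusSynthesis_mem_trigPoly (N : ℕ) (c : (Fin 3 → ℤ) → ℂ) :
    torusSynthesis N c ∈ trigPoly N := by
  have e : torusSynthesis N c = ∑ k ∈ Finset.Icc (-(N : ℤ)) N, ∑ j ∈ Finset.Icc (-(N : ℤ)) N,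
      ∑ l ∈ Finset.Icc (-(N : ℤ)) N, c ![k, j, l] • torusChar ![k, j, l] := by
    funext x
    simp [torusSynthesis]
  rw [e]
  refine Submodule.sum_mem _ fun k hk => Submodule.sum_mem _ fun j hj =>
    Submodule.sum_mem _ fun l hl => Submodule.smul_mem _ _ (Submodule.subset_span ⟨_, ?_, rfl⟩)
  rw [mem_Icc_iff_abs_le] at hk hj hl
  rw [Fin.forall_fin_succ, Fin.forall_fin_two]
  exact ⟨hk, hj, hl⟩

/-! ### The harmonic series -/

/-- The harmonic series as a linear map. -/
def harmSynthesisLM (N : ℕ) : HarmCoeffs →ₗ[ℂ] (SO3 → ℂ) where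
  toFun := harmSynthesis N
  map_add' c d := by
    funext R
    simp only [harmSynthesis, Pi.add_apply, add_mul, Finset.sum_add_distrib]
  map_smul' z c := by
    funext R
    simp only [harmSynthesis, Pi.smul_apply, smul_eq_mul, RingHom.id_apply, Finset.mul_sum,
      mul_assoc]

/-- The range of a linear map is a subspace, so it suffices to realize each spanning function by a
family with a single nonzero coefficient. -/
theorem bandLimited_le_range (N : ℕ) : bandLimited N ≤ LinearMap.range (harmSynthesisLM N) := by
  refine iSup₂_le fun n hn => Submodule.span_le.mpr ?_
  rintro _ ⟨k, l, hk, hl, rfl⟩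
  refine ⟨Pi.single n (Pi.single k (Pi.single l 1)), ?_⟩
  funext R
  change harmSynthesis N _ R = _
  rw [harmSynthesis, Finset.sum_eq_single n, Finset.sum_eq_single k, Finset.sum_eq_single l]
  · simp
  · intro l' _ h; simp [h]
  · exact fun h => absurd (mem_Icc_iff_abs_le.mpr hl) h
  · intro k' _ h; simp [h]
  · exact fun h => absurd (mem_Icc_iff_abs_le.mpr hk) h
  · intro n' _ h; simp [h]
  · exact fun h => absurd hn h

/-- Orthonormality extracts the coefficient. The bounds on n, k, l matter, since entries of c
outside them do not enter the series. Both existence and uniqueness of the expansion come from here.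
-/
theorem harmCoeff_harmSynthesis {N n : ℕ} (c : HarmCoeffs) {k l : ℤ} (hn : n ≤ N) (hk : |k| ≤ n)
    (hl : |l| ≤ n) : harmCoeff (harmSynthesis N c) n k l = c n k l := by
  have e : ∀ R, harmSynthesis N c R * (starRingEnd ℂ) (wignerD n k l R) =
      ∑ n' ∈ Finset.range (N + 1), ∑ k' ∈ Finset.Icc (-(n' : ℤ)) n',
        ∑ l' ∈ Finset.Icc (-(n' : ℤ)) n',
          c n' k' l' * (wignerD n' k' l' R * (starRingEnd ℂ) (wignerD n k l R)) := by
    intro R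
    simp only [harmSynthesis, Finset.sum_mul, mul_assoc]
  have hint : ∀ n' : ℕ, ∀ k' ∈ Finset.Icc (-(n' : ℤ)) n', ∀ l' ∈ Finset.Icc (-(n' : ℤ)) n',
      Integrable (fun R => c n' k' l' * (wignerD n' k' l' R * (starRingEnd ℂ) (wignerD n k l R)))
        haarSO3 := fun n' k' hk' l' hl' => (integrable_of_continuous
      ((continuous_wignerD (mem_Icc_iff_abs_le.mp hk') (mem_Icc_iff_abs_le.mp hl')).mul
        (Complex.continuous_conj.comp (continuous_wignerD hk hl)))).const_mul _
  simp only [harmCoeff, e]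
  rw [integral_finsetSum _ fun n' _ => integrable_finsetSum _ fun k' hk' =>
    integrable_finsetSum _ (hint n' k' hk')]
  have h : ∀ n' ∈ Finset.range (N + 1), ∫ R, ∑ k' ∈ Finset.Icc (-(n' : ℤ)) n',
        ∑ l' ∈ Finset.Icc (-(n' : ℤ)) n',
          c n' k' l' * (wignerD n' k' l' R * (starRingEnd ℂ) (wignerD n k l R)) ∂haarSO3 =
      ∑ k' ∈ Finset.Icc (-(n' : ℤ)) n', ∑ l' ∈ Finset.Icc (-(n' : ℤ)) n',
        c n' k' l' * if n' = n ∧ k' = k ∧ l' = l then 1 else 0 := by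
    intro n' _
    rw [integral_finsetSum _ fun k' hk' => integrable_finsetSum _ (hint n' k' hk')]
    refine Finset.sum_congr rfl fun k' hk' => ?_
    rw [integral_finsetSum _ (hint n' k' hk')]
    refine Finset.sum_congr rfl fun l' hl' => ?_
    rw [integral_const_mul, integral_wignerD_mul_conj (mem_Icc_iff_abs_le.mp hl') hl
      (mem_Icc_iff_abs_le.mp hk') hk]
  rw [Finset.sum_congr rfl h, Finset.sum_eq_single n, Finset.sum_eq_single k,
    Finset.sum_eq_single l]
  · simp
  · intro l' _ h; simp [h]
  · exact fun h => absurd (mem_Icc_iff_abs_le.mpr hl) h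
  · intro k' _ h; simp [h]
  · exact fun h => absurd (mem_Icc_iff_abs_le.mpr hk) h
  · intro n' _ h; simp [h]
  · exact fun h => absurd (Finset.mem_range.mpr (Nat.lt_succ_of_le hn)) h

/-! ### Reordering the sums and the DFS transform of a harmonic series. -/

theorem sum_Icc_exchange (N : ℕ) (F : ℕ → ℤ → ℤ → ℤ → ℂ) :
    ∑ n ∈ Finset.range (N + 1), ∑ k ∈ Finset.Icc (-(n : ℤ)) n, ∑ j ∈ Finset.Icc (-(n : ℤ)) n,
      ∑ l ∈ Finset.Icc (-(n : ℤ)) n, F n k j l =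
    ∑ k ∈ Finset.Icc (-(N : ℤ)) N, ∑ j ∈ Finset.Icc (-(N : ℤ)) N, ∑ l ∈ Finset.Icc (-(N : ℤ)) N,
      ∑ n ∈ Finset.Icc (max k.natAbs (max j.natAbs l.natAbs)) N, F n k j l := by
  -- Each exchange moves the sum over n inward past one index and adds the absolute value of that
  -- index to the lower bound for n.
  rw [Finset.sum_comm' (t' := Finset.Icc (-(N : ℤ)) N) (s' := fun k => Finset.Icc k.natAbs N)
    (by intro n k; simp only [Finset.mem_range, Finset.mem_Icc]; omega)]
  refine Finset.sum_congr rfl fun k _ => ?_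
  rw [Finset.sum_comm' (t' := Finset.Icc (-(N : ℤ)) N)
    (s' := fun j => Finset.Icc (max k.natAbs j.natAbs) N)
    (by intro n j; simp only [Finset.mem_Icc]; omega)]
  refine Finset.sum_congr rfl fun j _ => ?_
  rw [Finset.sum_comm' (t' := Finset.Icc (-(N : ℤ)) N)
    (s' := fun l => Finset.Icc (max k.natAbs (max j.natAbs l.natAbs)) N)
    (by intro n l; simp only [Finset.mem_Icc]; omega)]

theorem sum_Icc_neg (n : ℕ) (F : ℤ → ℂ) :
    ∑ k ∈ Finset.Icc (-(n : ℤ)) n, F (-k) = ∑ k ∈ Finset.Icc (-(n : ℤ)) n, F k := by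
  refine Finset.sum_nbij' (fun k => -k) (fun k => -k) ?_ ?_ ?_ ?_ ?_ <;>
    simp only [Finset.mem_Icc, neg_neg, implies_true] <;> intros <;> omega

/-- The DFS transform of a harmonic series is the Fourier series whose coefficients are given by
the Wigner transform. -/
theorem dfs_harmSynthesis (N : ℕ) (c : HarmCoeffs) :
    dfs (harmSynthesis N c) = torusSynthesis N (wignerTransform N c) := by
  funext x
  change harmSynthesis N c (phiSO3 x) = _
  have h1 : harmSynthesis N c (phiSO3 x) =
      ∑ n ∈ Finset.range (N + 1), ∑ k ∈ Finset.Icc (-(n : ℤ)) n, ∑ j ∈ Finset.Icc (-(n : ℤ)) n,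
        ∑ l ∈ Finset.Icc (-(n : ℤ)) n, Complex.I ^ (k - l) *
          (((√(2 * n + 1 : ℝ) * wignerd n j k 0 * wignerd n j l 0 : ℝ) : ℂ) * c n (-k) (-l)) *
            torusChar ![k, j, l] x := by
    rw [harmSynthesis]
    refine Finset.sum_congr rfl fun n _ => ?_
    -- Substituting -k for k, and then -l for l, is the origin of the coefficient with negated
    -- indices in W_N.
    rw [← sum_Icc_neg]
    refine Finset.sum_congr rfl fun k hk => ?_
    rw [← sum_Icc_neg, Finset.sum_comm]
    refine Finset.sum_congr rfl fun l hl => ?_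
    rw [wignerD_phiSO3 (mem_Icc_iff_abs_le.mp hk) (mem_Icc_iff_abs_le.mp hl), Finset.mul_sum]
    exact Finset.sum_congr rfl fun j _ => by ring
  rw [h1, sum_Icc_exchange, torusSynthesis]
  refine Finset.sum_congr rfl fun k _ => Finset.sum_congr rfl fun j _ =>
    Finset.sum_congr rfl fun l _ => ?_
  rw [← Finset.sum_mul, ← Finset.mul_sum]
  rfl

theorem wignerTransform_eq_zero {N : ℕ} (c : HarmCoeffs) {m : Fin 3 → ℤ}
    (hm : ¬∀ i, |m i| ≤ (N : ℤ)) : wignerTransform N c m = 0 := by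
  have : Finset.Icc (max (m 0).natAbs (max (m 1).natAbs (m 2).natAbs)) N = ∅ := by
    rw [Finset.Icc_eq_empty_iff]
    intro h
    refine hm ?_
    rw [Fin.forall_fin_succ, Fin.forall_fin_two]
    change |m 0| ≤ (N : ℤ) ∧ |m 1| ≤ (N : ℤ) ∧ |m 2| ≤ (N : ℤ)
    simp only [Int.abs_eq_natAbs]
    omega
  change Complex.I ^ (m 0 - m 2) * Finset.sum _ _ = 0
  rw [this, Finset.sum_empty, mul_zero]

end WignerDFS

end

theorem mainTheorem3 (N : ℕ) (f : SO3 → ℂ) (hf : f ∈ bandLimited N) :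
    -- the inner products with the Wigner-D functions are the unique coefficients of the
    -- harmonic series of degree `N` that represents `f`
    f = harmSynthesis N (harmCoeff f) ∧
    (∀ c : HarmCoeffs, f = harmSynthesis N c →
      ∀ (n : ℕ) (k l : ℤ), n ≤ N → |k| ≤ (n : ℤ) → |l| ≤ (n : ℤ) → c n k l = harmCoeff f n k l) ∧
    -- the DFS transform of `f` is a trigonometric polynomial of degree at most `N`
    dfs f ∈ trigPoly N ∧
    -- it is the Fourier series whose coefficients are the Wigner transform of those of `f`
    dfs f = torusSynthesis N (wignerTransform N (harmCoeff f)) ∧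
    ∀ m : Fin 3 → ℤ, torusFourierCoeff (dfs f) m = wignerTransform N (harmCoeff f) m := by
  -- Any expansion of f will do; its coefficients inside the band turn out to be the harmonic
  -- coefficients.
  obtain ⟨c, rfl⟩ := bandLimited_le_range N hf
  change harmSynthesis N c = harmSynthesis N (harmCoeff (harmSynthesis N c)) ∧ _
  have uniq : ∀ d : HarmCoeffs, harmSynthesis N c = harmSynthesis N d →
      ∀ (n : ℕ) (k l : ℤ), n ≤ N → |k| ≤ (n : ℤ) → |l| ≤ (n : ℤ) →
        d n k l = harmCoeff (harmSynthesis N c) n k l := fun d hd n k l hn hk hl => by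
    rw [hd, harmCoeff_harmSynthesis d hn hk hl]
  have exp : harmSynthesis N c = harmSynthesis N (harmCoeff (harmSynthesis N c)) := by
    funext R
    refine Finset.sum_congr rfl fun n hn => Finset.sum_congr rfl fun k hk =>
      Finset.sum_congr rfl fun l hl => ?_
    rw [harmCoeff_harmSynthesis c (Nat.lt_succ_iff.mp (Finset.mem_range.mp hn))
      (mem_Icc_iff_abs_le.mp hk) (mem_Icc_iff_abs_le.mp hl)]
  have hdfs : dfs (harmSynthesis N c) =
      torusSynthesis N (wignerTransform N (harmCoeff (harmSynthesis N c))) := by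
    conv_lhs => rw [exp]
    exact dfs_harmSynthesis N _
  refine ⟨exp, uniq, ?_, hdfs, fun m => ?_⟩
  · change dfs (harmSynthesis N c) ∈ trigPoly N
    rw [hdfs]
    exact torusSynthesis_mem_trigPoly N _
  · change torusFourierCoeff (dfs (harmSynthesis N c)) m =
      wignerTransform N (harmCoeff (harmSynthesis N c)) m
    rw [hdfs, torusFourierCoeff_torusSynthesis]
    split_ifs with hm
    · rfl
    · exact (wignerTransform_eq_zero _ hm).symm
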